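/- Let $\Gamma$ be a chain of $g\ge 1$ loops separated by bridges of positive length: the $i$th loop ($1\le i\le g$) consists of a top edge of length $\ell_i>0$ and a bottom edge of length $m_i>0$, both joining a left vertex $v_i$ to a right vertex $w_i$, and the $i$th bridge ($1\le i<g$) joins $w_i$ to $v_{i+1}$. Assume that the edge lengths are generic: no $\ell_i/m_i$ equals the ratio of two positive integers whose sum is at most $2g-2$. Let $\gamma_i$ be the $i$th loop minus the point $w_i$. A divisor on $\Gamma$ is a finite formal $\mathbb{Z}$-combination of points; it is effective if its coefficients are nonnegative, and an effective divisor contains a point if its coefficient there is positive. Two divisors are equivalent if their difference is $\operatorname{div}(\psi)=\sum_{p}\operatorname{ord}_p(\psi)\,p$ for a continuous piecewise linear function $\psi$ on $\Gamma$ with integer slopes, where $\operatorname{ord}_p(\psi)$ is the sum of the incoming slopes of $\psi$ at $p$. A divisor $D$ has rank at least $r$ if $D-A$ is equivalent to an effective divisor for every effective divisor $A$ of degree $r$. A divisor $D$ is $q$-reduced if its coefficients at all points other than $q$ are nonnegative and every nonempty closed connected set $A\not\ni q$ has a boundary point at which the coefficient of $D$ is less than the number of tangent directions leaving $A$. Let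 $r,d\ge 0$ be integers with $\rho(g,r,d)=g-(r+1)(g-d+r)=0$. Given a standard Young tableau $T$ of rectangular shape with $g-d+r$ rows and $r+1$ columns, with entries $1,\dots,g$ and columns numbered $0,\dots,r$, define $p_0,\dots,p_g\in\mathbb{Z}^r$ by $p_0=(r,r-1,\dots,1)$ and $p_i-p_{i-1}=e_j$ if $i$ appears in column $j<r$, and $p_i-p_{i-1}=(-1,\dots,-1)$ if $i$ appears in column $r$ (coordinates are numbered $0,\dots,r-1$). Let $D_T$ be the sum of $r\,v_1$ and, for each $i$ that appears in a column $j<r$ of $T$, the point of the $i$th loop at distance $p_{i-1}(j)\,m_i$ modulo $\ell_i+m_i$ counterclockwise from $w_i$ (that is, starting from $w_i$ along the top edge). Let $D$ be a $v_1$-reduced divisor on $\Gamma$ of degree $d$ and rank at least $r$. Then there is exactly one such tableau $T$ with $D=D_T$ (the tableau corresponding to $D$). For each integer $0\le j\le r$ there is a unique divisor $D_j$ equivalent to $D$ such that $D_j-j\,v_1-(r-j)\,w_g$ is effective. Moreover, for every $1\le i\le g$, the cell $\gamma_i$ contains no point of $D_j$ if and only if $i$ appears in the $j$th column of the tableau corresponding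 to $D$. -/

import Mathlib

open Set Filter Topology

noncomputable section

/-- A (model of a) metric graph: vertices `V`, edges `E`, each edge `e` being a copy of the
interval `[0, len e]` whose end `0` is glued to `src e` and whose end `len e` to `tgt e`. -/
structure MetricGraph (V E : Type) where
  src : E → V
  tgt : E → V
  len : E → ℝ
  len_pos : ∀ e, 0 < len e

namespace MetricGraph

variable {V E : Type}

/-- The points of a metric graph: its vertices and the interior points of its edges. -/
inductive Point (Γ : MetricGraph V E) : Type
  | vertex (v : V) : Point Γ
  | inner (e : E) (t : Ioo (0 : ℝ) (Γ.len e)) : Point Γ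

/-- The point at distance `t` from the source along the edge `e`, for `0 ≤ t ≤ len e`
(real numbers outside this interval are sent to the nearer endpoint of the edge). -/
def edgePt (Γ : MetricGraph V E) (e : E) (t : ℝ) : Γ.Point :=
  if h₀ : t ≤ 0 then .vertex (Γ.src e)
  else if h₁ : Γ.len e ≤ t then .vertex (Γ.tgt e)
  else .inner e ⟨t, lt_of_not_ge h₀, lt_of_not_ge h₁⟩

/-- The quotient topology: a set is open iff its preimage in every edge is. -/
instance (Γ : MetricGraph V E) : TopologicalSpace Γ.Point :=
  ⨆ e, TopologicalSpace.coinduced (Γ.edgePt e) inferInstance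

/-- `PL(Γ)`: the continuous piecewise linear functions with integer slopes. On each (closed) edge
there are finitely many break points, and the function is affine with integer slope on every closed
subinterval with no break point in its interior. -/
def IsPL (Γ : MetricGraph V E) (f : Γ.Point → ℝ) : Prop :=
  ∀ e, ∃ S : Finset ℝ, ∀ a b : ℝ, 0 ≤ a → a < b → b ≤ Γ.len e → Disjoint (Ioo a b) (S : Set ℝ) →
    ∃ n : ℤ, ∀ t ∈ Icc a b, f (Γ.edgePt e t) = f (Γ.edgePt e a) + n * (t - a)

/-- The derivative of `f` from the left at the point `t` of the edge `e`. -/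
def leftSlope (Γ : MetricGraph V E) (f : Γ.Point → ℝ) (e : E) (t : ℝ) : ℝ :=
  derivWithin (fun s => f (Γ.edgePt e s)) (Iio t) t

/-- The derivative of `f` from the right at the point `t` of the edge `e`. -/
def rightSlope (Γ : MetricGraph V E) (f : Γ.Point → ℝ) (e : E) (t : ℝ) : ℝ :=
  derivWithin (fun s => f (Γ.edgePt e s)) (Ioi t) t

open Classical in
/-- The order of `f` at a point: the sum of the incoming slopes along the edges at that point. -/
def ord [Fintype E] (Γ : MetricGraph V E) (f : Γ.Point → ℝ) : Γ.Point → ℝ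
  | .vertex v => ∑ e, ((if Γ.tgt e = v then Γ.leftSlope f e (Γ.len e) else 0)
      - (if Γ.src e = v then Γ.rightSlope f e 0 else 0))
  | .inner e t => Γ.leftSlope f e t - Γ.rightSlope f e t

/-- Divisors: finite formal integer combinations of points. The order `≤` on divisors is
coefficientwise, so that `0 ≤ D` says that `D` is effective. -/
abbrev Divisor (Γ : MetricGraph V E) : Type := Γ.Point →₀ ℤ

/-- The degree of a divisor. -/
def degree (Γ : MetricGraph V E) (D : Γ.Divisor) : ℤ := D.sum fun _ a => a

/-- Linear equivalence: `D - D'` is the divisor of a piecewise linear function. -/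
def LinEquiv [Fintype E] (Γ : MetricGraph V E) (D D' : Γ.Divisor) : Prop :=
  ∃ f : Γ.Point → ℝ, Γ.IsPL f ∧ ∀ p, (((D - D') p : ℤ) : ℝ) = Γ.ord f p

/-- `D` has rank at least `r`: for every effective divisor `A` of degree `r`, the divisor `D - A`
is equivalent to an effective divisor. -/
def RankAtLeast [Fintype E] (Γ : MetricGraph V E) (D : Γ.Divisor) (r : ℕ) : Prop :=
  ∀ A : Γ.Divisor, 0 ≤ A → Γ.degree A = r → ∃ F : Γ.Divisor, 0 ≤ F ∧ Γ.LinEquiv (D - A) F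

open Classical in
/-- The number of tangent directions at a point that point out of the set `A`. -/
def outdeg [Fintype E] (Γ : MetricGraph V E) (A : Set Γ.Point) : Γ.Point → ℕ
  | .vertex v =>
      ∑ e, ((if Γ.tgt e = v ∧ ∀ᶠ s in 𝓝[<] (Γ.len e), Γ.edgePt e s ∉ A then 1 else 0)
        + (if Γ.src e = v ∧ ∀ᶠ s in 𝓝[>] (0 : ℝ), Γ.edgePt e s ∉ A then 1 else 0))
  | .inner e t =>
      (if ∀ᶠ s in 𝓝[<] (t : ℝ), Γ.edgePt e s ∉ A then 1 else 0)
        + (if ∀ᶠ s in 𝓝[>] (t : ℝ), Γ.edgePt e s ∉ A then 1 else 0)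

/-- `D` is `q`-reduced: its coefficients away from `q` are nonnegative, and every (nonempty)
closed connected set `A` not containing `q` has a boundary point whose coefficient is smaller than
the number of directions leaving `A` there. -/
def IsReduced [Fintype E] (Γ : MetricGraph V E) (q : Γ.Point) (D : Γ.Divisor) : Prop :=
  (∀ p, p ≠ q → 0 ≤ D p) ∧
    ∀ A : Set Γ.Point, IsClosed A → IsConnected A → q ∉ A →
      ∃ p ∈ frontier A, D p < Γ.outdeg A p

end MetricGraph

/-- The data of a chain of `g ≥ 1` loops separated by bridges. Loops are indexed by `Fin g`, so the
loop with index `i` is the `(i+1)`-st one. The `i`-th loop consists of a top edge of length `ℓ i`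
and a bottom edge of length `m i`, both joining `v i` to `w i`; the `i`-th bridge joins `w i`
to `v (i+1)`. -/
structure ChainOfLoops (g : ℕ) where
  g_pos : 0 < g
  ℓ : Fin g → ℝ
  m : Fin g → ℝ
  br : Fin (g - 1) → ℝ
  ℓ_pos : ∀ i, 0 < ℓ i
  m_pos : ∀ i, 0 < m i
  br_pos : ∀ i, 0 < br i

namespace ChainOfLoops

variable {g : ℕ}

/-- The metric graph: `Sum.inl i` is the vertex `v i`, `Sum.inr i` the vertex `w i`; the edges are
the top edges (from `w i` to `v i`), the bottom edges (from `v i` to `w i`) and the bridges, in this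
order. With `v i` on the left and `w i` on the right of the loop, the top edge followed by the bottom
edge runs once around the loop counterclockwise, starting from `w i`. -/
def graph (Γ : ChainOfLoops g) :
    MetricGraph (Fin g ⊕ Fin g) (Fin g ⊕ Fin g ⊕ Fin (g - 1)) where
  src := Sum.elim Sum.inr (Sum.elim Sum.inl fun i => Sum.inr ⟨i, by omega⟩)
  tgt := Sum.elim Sum.inl (Sum.elim Sum.inr fun i => Sum.inl ⟨i + 1, by omega⟩)
  len := Sum.elim Γ.ℓ (Sum.elim Γ.m Γ.br)
  len_pos := by
    rintro (i | i | i)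
    exacts [Γ.ℓ_pos i, Γ.m_pos i, Γ.br_pos i]

/-- The left vertex of the `i`-th loop. -/
def v (Γ : ChainOfLoops g) (i : Fin g) : Γ.graph.Point := .vertex (Sum.inl i)

/-- The right vertex of the `i`-th loop. -/
def w (Γ : ChainOfLoops g) (i : Fin g) : Γ.graph.Point := .vertex (Sum.inr i)

/-- The leftmost vertex of the chain. -/
def vFirst (Γ : ChainOfLoops g) : Γ.graph.Point := Γ.v ⟨0, Γ.g_pos⟩

/-- The rightmost vertex of the chain. -/
def wLast (Γ : ChainOfLoops g) : Γ.graph.Point := Γ.w ⟨g - 1, Nat.sub_one_lt_of_lt Γ.g_pos⟩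

/-- The cell `γ i`: the `i`-th loop without the vertex `w i`. -/
def cell (Γ : ChainOfLoops g) (i : Fin g) : Set Γ.graph.Point :=
  (range (Γ.graph.edgePt (Sum.inl i)) ∪ range (Γ.graph.edgePt (Sum.inr (Sum.inl i)))) \ {Γ.w i}

/-- The point on the `i`-th loop at distance `x`, modulo `ℓ i + m i`, counterclockwise
from `w i`. -/
def loopPt (Γ : ChainOfLoops g) (i : Fin g) (x : ℝ) : Γ.graph.Point :=
  let t := toIcoMod (add_pos (Γ.ℓ_pos i) (Γ.m_pos i)) 0 x
  if t ≤ Γ.ℓ i then Γ.graph.edgePt (Sum.inl i) t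
  else Γ.graph.edgePt (Sum.inr (Sum.inl i)) (t - Γ.ℓ i)

/-- Generic edge lengths: no ratio `ℓ i / m i` is a ratio of two positive integers with sum at
most `2g - 2`. -/
def IsGeneric (Γ : ChainOfLoops g) : Prop :=
  ∀ i, ∀ a b : ℕ, 0 < a → 0 < b → a + b + 2 ≤ 2 * g → Γ.ℓ i / Γ.m i ≠ a / b

end ChainOfLoops

/-- The Brill–Noether number. -/
def brillNoether (g r d : ℕ) : ℤ := g - (r + 1) * (g - d + r)

/-- Standard Young tableaux of rectangular shape with `s` rows and `c` columns. Rows, columns and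
entries are numbered from `0`, so that the entry `i : Fin n` stands for the number `i + 1`. -/
structure RectTableau (s c n : ℕ) where
  entry : Fin s → Fin c → Fin n
  bijective : Function.Bijective fun x : Fin s × Fin c => entry x.1 x.2
  row_strictMono : ∀ a, StrictMono (entry a)
  col_strictMono : ∀ b, StrictMono fun a => entry a b

namespace RectTableau

/-- The column in which `i` appears. -/
def col {s c n : ℕ} (T : RectTableau s c n) (i : Fin n) : Fin c :=
  ((Equiv.ofBijective _ T.bijective).symm i).2

/-- The path `p_0, p_1, …, p_n` in `ℤ^r` of a tableau with `r + 1` columns: it starts at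
`(r, …, 1)`, and a step is the standard basis vector `e_j` if the corresponding number appears in
the column `j < r`, and `(-1, …, -1)` if it appears in the last column. (It is constant
after the last step.) -/
def path {s r n : ℕ} (T : RectTableau s (r + 1) n) : ℕ → Fin r → ℤ
  | 0 => fun j => (r : ℤ) - j
  | i + 1 => fun j => T.path i j +
      if h : i < n then
        if (T.col ⟨i, h⟩ : ℕ) = r then -1
        else if (T.col ⟨i, h⟩ : ℕ) = j then 1 else 0
      else 0

end RectTableau

namespace ChainOfLoops

/-- The divisor corresponding to a tableau: the leftmost vertex has coefficient `r`, and for each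
loop `i` whose number appears in a column `j < r` there is one further point, at distance
`p(j) * m i` counterclockwise from `w i`, where `p` is the point of the path just before the step
of the loop `i`. -/
def tableauDivisor {g : ℕ} (Γ : ChainOfLoops g) {s r : ℕ} (T : RectTableau s (r + 1) g) :
    Γ.graph.Divisor :=
  Finsupp.single Γ.vFirst (r : ℤ) +
    ∑ i : Fin g, if h : (T.col i : ℕ) < r then
      Finsupp.single (Γ.loopPt i (T.path i ⟨T.col i, h⟩ * Γ.m i)) 1 else 0

end ChainOfLoops

end

/-! Retract the graph onto the loop i and add up the positions of the points of a divisor in the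
circle ℝ/(ℓ_i + m_i). This Abel–Jacobi component depends only on the class
(`abelJacobi_eq_of_linEquiv`). If an effective divisor has a points to the left of the loop and none
on it or on the bridge to its right (v_1 counting as left of the first loop), the component is a·ℓ_i
(`abelJacobi_of_leftDeg_eq`). For generic lengths at most one a in the relevant range fits the class
of D. So the left degree of an effective divisor with the components of D grows by at least one at
each loop, except possibly at this lingering value.

This produces lower bounds b_i(0) < … < b_i(r) (`lingerSeq`), starting from 0, …, r. An effective
divisor of degree k can force all left degrees at the loop i to be at least b_i(k)
(`exists_forcing`). Rank at least r then gives b_g(k) ≤ d - r + k (`lingerSeq_last_le`): each bound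
lingers at least g - d + r times. At most one bound lingers per loop, and ρ = 0 says (r+1)(g-d+r) =
g, so exactly one does (`lingerSeq.exists_col`). Its index is the column of the loop in the tableau;
that the bounds stay strictly ordered is the ballot condition for standardness.

The divisor D_j - (r-j)w_g has degree b_g(j) and coefficient at least j at v_1, which squeezes its
left degrees to b_i(j) (`leftDeg_eq`). It has no point on the loops of column j, and on every other
loop one point whose position is dictated by the Abel–Jacobi component (`eq_formula`). Since D is
reduced, its coefficient at v_1 is at least r (`IsReduced.coeff_le`), so D is the case j = r, where
the formula reads D_T. -/

noncomputable section

namespace MetricGraph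

variable {V E : Type}

/-! ### Slopes on an edge and summation by parts. -/

section Affine

theorem derivWithin_Iio_of_affine {φ : ℝ → ℝ} {a b n : ℝ} (hab : a < b)
    (h : ∀ t ∈ Icc a b, φ t = φ a + n * (t - a)) : derivWithin φ (Iio b) b = n := by
  have h1 : HasDerivWithinAt (fun t => φ a + n * (t - a)) n (Iio b) b := by
    simpa using ((((hasDerivAt_id b).sub_const a).const_mul n).const_add (φ a)).hasDerivWithinAt
  refine HasDerivWithinAt.derivWithin (h1.congr_of_eventuallyEq ?_ (h b ⟨hab.le, le_rfl⟩))
    (uniqueDiffWithinAt_Iio b)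
  filter_upwards [Ioo_mem_nhdsLT hab] with t ht using h t ⟨ht.1.le, ht.2.le⟩

theorem derivWithin_Ioi_of_affine {φ : ℝ → ℝ} {a b n : ℝ} (hab : a < b)
    (h : ∀ t ∈ Icc a b, φ t = φ a + n * (t - a)) : derivWithin φ (Ioi a) a = n := by
  have h1 : HasDerivWithinAt (fun t => φ a + n * (t - a)) n (Ioi a) a := by
    simpa using ((((hasDerivAt_id a).sub_const a).const_mul n).const_add (φ a)).hasDerivWithinAt
  refine HasDerivWithinAt.derivWithin (h1.congr_of_eventuallyEq ?_ (h a ⟨le_rfl, hab.le⟩))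
    (uniqueDiffWithinAt_Ioi a)
  filter_upwards [Ioo_mem_nhdsGT hab] with t ht using h t ⟨ht.1.le, ht.2.le⟩

/-- Discrete integration by parts for a piecewise linear function against an affine one. -/
theorem sum_slope_change_mul_affine {φ : ℝ → ℝ} (α β : ℝ) (S : Finset ℝ) :
    ∀ L : ℝ, 0 < L → (∀ t ∈ S, t ∈ Ioo 0 L) →
    (∀ a b : ℝ, 0 ≤ a → a < b → b ≤ L → Disjoint (Ioo a b) (S : Set ℝ) →
      ∃ n : ℤ, ∀ t ∈ Icc a b, φ t = φ a + n * (t - a)) →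
    ∑ t ∈ S, (derivWithin φ (Iio t) t - derivWithin φ (Ioi t) t) * (α + β * t) =
      α * (derivWithin φ (Ioi 0) 0 - derivWithin φ (Iio L) L) +
        β * (φ L - φ 0 - L * derivWithin φ (Iio L) L) := by
  induction S using Finset.induction_on_max with
  | empty =>
    intro L hL _ h
    obtain ⟨n, hn⟩ := h 0 L le_rfl hL le_rfl (by simp)
    rw [derivWithin_Iio_of_affine hL hn, derivWithin_Ioi_of_affine hL hn, hn L ⟨hL.le, le_rfl⟩,
      Finset.sum_empty]
    ring
  | insert b S hb ih =>
    intro L hL hS h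
    have hbL := hS b (Finset.mem_insert_self _ _)
    obtain ⟨n, hn⟩ := h b L hbL.1.le hbL.2 le_rfl (by
      rw [Set.disjoint_left]
      intro t ht hts
      rcases Finset.mem_insert.1 (Finset.mem_coe.1 hts) with rfl | hts
      · exact lt_irrefl _ ht.1
      · exact lt_asymm ht.1 (hb t hts))
    have key := ih b hbL.1
      (fun t ht => ⟨(hS t (Finset.mem_insert_of_mem ht)).1, hb t ht⟩)
      (fun a c ha hac hcb hd => h a c ha hac (hcb.trans hbL.2.le) (by
        rw [Set.disjoint_left] at hd ⊢
        intro t ht hts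
        rcases Finset.mem_insert.1 (Finset.mem_coe.1 hts) with rfl | hts
        · exact absurd ht.2 (not_lt.2 hcb)
        · exact hd ht hts))
    rw [Finset.sum_insert (fun hbS => lt_irrefl _ (hb b hbS)), key,
      derivWithin_Iio_of_affine hbL.2 hn, derivWithin_Ioi_of_affine hbL.2 hn,
      hn L ⟨hbL.2.le, le_rfl⟩]
    ring

end Affine

/-! ### Piecewise linear functions: local form and continuity; compactness of the graph. -/

variable (Γ : MetricGraph V E)

theorem edgePt_of_nonpos (e : E) {t : ℝ} (h : t ≤ 0) : Γ.edgePt e t = .vertex (Γ.src e) := by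
  simp [edgePt, h]

theorem edgePt_of_len_le (e : E) {t : ℝ} (h : Γ.len e ≤ t) :
    Γ.edgePt e t = .vertex (Γ.tgt e) := by
  have := Γ.len_pos e
  simp [edgePt, h, (this.trans_le h).not_ge]

theorem edgePt_of_mem (e : E) {t : ℝ} (h : t ∈ Ioo 0 (Γ.len e)) :
    Γ.edgePt e t = .inner e ⟨t, h⟩ := by
  simp [edgePt, h.1.not_ge, h.2.not_ge]

variable {Γ}

/-- No restriction on t is needed: outside the edge `edgePt` is constant, so the slope is 0 there.
Continuity can thus be checked on all of ℝ, from which the topology of the graph is coinduced. -/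
theorem IsPL.exists_affine_left {f : Γ.Point → ℝ} (hf : Γ.IsPL f) (e : E) (t : ℝ) :
    ∃ a < t, ∃ n : ℤ, ∀ s ∈ Icc a t,
      f (Γ.edgePt e s) = f (Γ.edgePt e a) + n * (s - a) := by
  rcases le_or_gt t 0 with h0 | h0
  · refine ⟨t - 1, by linarith, 0, fun s hs => ?_⟩
    rw [Γ.edgePt_of_nonpos e (hs.2.trans h0), Γ.edgePt_of_nonpos e (by linarith)]
    simp
  rcases le_or_gt t (Γ.len e) with h1 | h1
  · obtain ⟨S, hS⟩ := hf e
    have hev : ∀ᶠ s in 𝓝[<] t, s ∉ (S : Set ℝ) := by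
      have : ∀ᶠ s in 𝓝 t, s ∉ ((S : Set ℝ) \ {t}) :=
        ((S.finite_toSet.subset sdiff_subset).isClosed.isOpen_compl).mem_nhds (by simp)
      filter_upwards [nhdsWithin_le_nhds this, self_mem_nhdsWithin] with s hs hst hsS
      exact hs ⟨hsS, (ne_of_lt hst)⟩
    obtain ⟨a, ha, hsub⟩ := (mem_nhdsLT_iff_exists_Ioo_subset' h0).1 hev
    have hat : max a 0 < t := max_lt ha h0
    obtain ⟨n, hn⟩ := hS (max a 0) t (le_max_right _ _) hat h1 (by
      rw [Set.disjoint_left]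
      intro s hs hsS
      exact hsub ⟨(le_max_left _ _).trans_lt hs.1, hs.2⟩ hsS)
    exact ⟨_, hat, n, hn⟩
  · refine ⟨Γ.len e, h1, 0, fun s hs => ?_⟩
    rw [Γ.edgePt_of_len_le e hs.1, Γ.edgePt_of_len_le e le_rfl]
    simp

theorem IsPL.exists_affine_right {f : Γ.Point → ℝ} (hf : Γ.IsPL f) (e : E) (t : ℝ) :
    ∃ b > t, ∃ n : ℤ, ∀ s ∈ Icc t b,
      f (Γ.edgePt e s) = f (Γ.edgePt e t) + n * (s - t) := by
  rcases lt_or_ge t 0 with h0 | h0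
  · refine ⟨0, h0, 0, fun s hs => ?_⟩
    rw [Γ.edgePt_of_nonpos e hs.2, Γ.edgePt_of_nonpos e h0.le]
    simp
  rcases lt_or_ge t (Γ.len e) with h1 | h1
  · obtain ⟨S, hS⟩ := hf e
    have hev : ∀ᶠ s in 𝓝[>] t, s ∉ (S : Set ℝ) := by
      have : ∀ᶠ s in 𝓝 t, s ∉ ((S : Set ℝ) \ {t}) :=
        ((S.finite_toSet.subset sdiff_subset).isClosed.isOpen_compl).mem_nhds (by simp)
      filter_upwards [nhdsWithin_le_nhds this, self_mem_nhdsWithin] with s hs hst hsS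
      exact hs ⟨hsS, (ne_of_gt hst)⟩
    obtain ⟨b, hb, hsub⟩ := (mem_nhdsGT_iff_exists_Ioo_subset' h1).1 hev
    have htb : t < min b (Γ.len e) := lt_min hb h1
    obtain ⟨n, hn⟩ := hS t (min b (Γ.len e)) h0 htb (min_le_right _ _) (by
      rw [Set.disjoint_left]
      intro s hs hsS
      exact hsub ⟨hs.1, hs.2.trans_le (min_le_left _ _)⟩ hsS)
    exact ⟨_, htb, n, hn⟩
  · refine ⟨t + 1, by linarith, 0, fun s hs => ?_⟩
    rw [Γ.edgePt_of_len_le e (h1.trans hs.1), Γ.edgePt_of_len_le e h1]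
    simp

theorem IsPL.exists_leftSlope_eq {f : Γ.Point → ℝ} (hf : Γ.IsPL f) (e : E) (t : ℝ) :
    ∃ n : ℤ, Γ.leftSlope f e t = n := by
  obtain ⟨a, ha, n, hn⟩ := hf.exists_affine_left e t
  exact ⟨n, derivWithin_Iio_of_affine (φ := fun s => f (Γ.edgePt e s)) ha hn⟩

theorem IsPL.neg {f : Γ.Point → ℝ} (hf : Γ.IsPL f) : Γ.IsPL (-f) := by
  intro e
  obtain ⟨S, hS⟩ := hf e
  refine ⟨S, fun a b ha hab hb hd => ?_⟩
  obtain ⟨n, hn⟩ := hS a b ha hab hb hd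
  refine ⟨-n, fun t ht => ?_⟩
  simp only [Pi.neg_apply, hn t ht]
  push_cast
  ring

theorem ord_neg [Fintype E] (f : Γ.Point → ℝ) (p : Γ.Point) : Γ.ord (-f) p = -Γ.ord f p := by
  have hl : ∀ e t, Γ.leftSlope (-f) e t = -Γ.leftSlope f e t := fun e t => derivWithin.fun_neg
  have hr : ∀ e t, Γ.rightSlope (-f) e t = -Γ.rightSlope f e t := fun e t => derivWithin.fun_neg
  cases p with
  | vertex v =>
    simp only [ord, hl, hr, ← Finset.sum_neg_distrib]
    refine Finset.sum_congr rfl fun e _ => ?_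
    split_ifs <;> ring
  | inner e t => simp only [ord, hl, hr]; ring

theorem LinEquiv.symm [Fintype E] {D D' : Γ.Divisor} (h : Γ.LinEquiv D D') :
    Γ.LinEquiv D' D := by
  obtain ⟨f, hf, hD⟩ := h
  refine ⟨-f, hf.neg, fun p => ?_⟩
  rw [ord_neg, ← hD p, ← neg_sub D D', Finsupp.neg_apply]
  push_cast
  rfl

theorem LinEquiv.of_sub_eq_sub [Fintype E] {D D' F F' : Γ.Divisor} (h : Γ.LinEquiv D D')
    (e : D - D' = F - F') : Γ.LinEquiv F F' := by
  obtain ⟨f, hf, hD⟩ := h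
  exact ⟨f, hf, e ▸ hD⟩

theorem continuous_edgePt (e : E) : Continuous (Γ.edgePt e) :=
  continuous_iff_coinduced_le.2 (le_iSup (fun e => TopologicalSpace.coinduced (Γ.edgePt e) _) e)

theorem IsPL.continuous {f : Γ.Point → ℝ} (hf : Γ.IsPL f) : Continuous f := by
  refine continuous_iSup_dom.2 fun e => continuous_coinduced_dom.2 ?_
  refine continuous_iff_continuousAt.2 fun t => continuousAt_iff_continuous_left_right.2 ⟨?_, ?_⟩
  · obtain ⟨a, ha, n, hn⟩ := hf.exists_affine_left e t
    have : ContinuousWithinAt (fun s => f (Γ.edgePt e a) + n * (s - a)) (Iic t) t := by fun_prop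
    refine this.congr_of_eventuallyEq ?_ (hn t ⟨ha.le, le_rfl⟩)
    filter_upwards [Icc_mem_nhdsLE ha] with s hs using hn s hs
  · obtain ⟨b, hb, n, hn⟩ := hf.exists_affine_right e t
    have : ContinuousWithinAt (fun s => f (Γ.edgePt e t) + n * (s - t)) (Ici t) t := by fun_prop
    refine this.congr_of_eventuallyEq ?_ (hn t ⟨le_rfl, hb.le⟩)
    filter_upwards [Icc_mem_nhdsGE hb] with s hs using hn s hs

theorem isCompact_univ_point [Finite V] [Finite E] : IsCompact (univ : Set Γ.Point) := by
  have h : (univ : Set Γ.Point) =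
      range Point.vertex ∪ ⋃ e, image (Γ.edgePt e) (Icc 0 (Γ.len e)) := by
    refine (eq_univ_of_forall fun p => ?_).symm
    cases p with
    | vertex v => exact Or.inl ⟨v, rfl⟩
    | inner e t =>
      exact Or.inr (mem_iUnion.2 ⟨e, t, ⟨t.2.1.le, t.2.2.le⟩, Γ.edgePt_of_mem e t.2⟩)
  rw [h]
  exact (finite_range _).isCompact.union
    (isCompact_iUnion fun e => isCompact_Icc.image (continuous_edgePt e))

/-! ### Maximum sets and reduced divisors. -/

section MaxSet

variable {f : Γ.Point → ℝ} {M : ℝ}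

open Classical in
-- At a maximum the incoming slope is nonnegative. Slope zero would keep a whole segment in the same
-- component of the maximum set, so in a direction that leaves the component the slope, an integer,
-- is at least 1.
theorem IsPL.outward_left_le (hf : Γ.IsPL f) (hM : ∀ p, f p ≤ M) {x : Γ.Point} (e : E) (t : ℝ)
    (ht : Γ.edgePt e t ∈ connectedComponentIn {p | f p = M} x) :
    (if ∀ᶠ s in 𝓝[<] t, Γ.edgePt e s ∉ connectedComponentIn {p | f p = M} x
      then (1 : ℝ) else 0) ≤ Γ.leftSlope f e t := by
  obtain ⟨a, ha, n, hn⟩ := hf.exists_affine_left e t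
  have hsl : Γ.leftSlope f e t = n :=
    derivWithin_Iio_of_affine (φ := fun s => f (Γ.edgePt e s)) ha hn
  have htM : f (Γ.edgePt e t) = M := connectedComponentIn_subset {p | f p = M} x ht
  have hat := hn t ⟨ha.le, le_rfl⟩
  have hn0 : (0 : ℝ) ≤ n := by
    have := hM (Γ.edgePt e a)
    by_contra! hneg
    nlinarith [sub_pos.2 ha]
  rw [hsl]
  split_ifs with hev
  · have h1 : n ≠ 0 := by
      rintro rfl
      have hseg : image (Γ.edgePt e) (Icc a t) ⊆ {p | f p = M} := by
        rintro _ ⟨s, hs, rfl⟩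
        have := hn s hs
        simp only [Int.cast_zero, zero_mul, add_zero] at this hat
        simp only [mem_ofPred_eq, this, ← hat, htM]
      have hsub := (isPreconnected_Icc.image _ (continuous_edgePt e).continuousOn
        ).subset_connectedComponentIn (mem_image_of_mem _ ⟨ha.le, le_rfl⟩) hseg
      rw [← connectedComponentIn_eq ht] at hsub
      obtain ⟨s, hs, hs'⟩ := (hev.and (Ioo_mem_nhdsLT ha)).exists
      exact hs (hsub ⟨s, ⟨hs'.1.le, hs'.2.le⟩, rfl⟩)
    have : 1 ≤ n := by
      have : (0 : ℤ) ≤ n := by exact_mod_cast hn0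
      omega
    exact_mod_cast this
  · exact hn0

open Classical in
theorem IsPL.outward_right_le (hf : Γ.IsPL f) (hM : ∀ p, f p ≤ M) {x : Γ.Point} (e : E) (t : ℝ)
    (ht : Γ.edgePt e t ∈ connectedComponentIn {p | f p = M} x) :
    (if ∀ᶠ s in 𝓝[>] t, Γ.edgePt e s ∉ connectedComponentIn {p | f p = M} x
      then (1 : ℝ) else 0) ≤ -Γ.rightSlope f e t := by
  obtain ⟨b, hb, n, hn⟩ := hf.exists_affine_right e t
  have hsl : Γ.rightSlope f e t = n :=
    derivWithin_Ioi_of_affine (φ := fun s => f (Γ.edgePt e s)) hb hn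
  have htM : f (Γ.edgePt e t) = M := connectedComponentIn_subset {p | f p = M} x ht
  have hbt := hn b ⟨hb.le, le_rfl⟩
  have hn0 : (n : ℝ) ≤ 0 := by
    have := hM (Γ.edgePt e b)
    by_contra! hneg
    nlinarith [sub_pos.2 hb]
  rw [hsl]
  split_ifs with hev
  · have h1 : n ≠ 0 := by
      rintro rfl
      have hseg : image (Γ.edgePt e) (Icc t b) ⊆ {p | f p = M} := by
        rintro _ ⟨s, hs, rfl⟩
        have := hn s hs
        simp only [Int.cast_zero, zero_mul, add_zero] at this
        simp only [mem_ofPred_eq, this, htM]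
      have hsub := (isPreconnected_Icc.image _ (continuous_edgePt e).continuousOn
        ).subset_connectedComponentIn (mem_image_of_mem _ ⟨le_rfl, hb.le⟩) hseg
      rw [← connectedComponentIn_eq ht] at hsub
      obtain ⟨s, hs, hs'⟩ := (hev.and (Ioo_mem_nhdsGT hb)).exists
      exact hs (hsub ⟨s, ⟨hs'.1.le, hs'.2.le⟩, rfl⟩)
    have : 1 ≤ -n := by
      have : n ≤ (0 : ℤ) := by exact_mod_cast hn0
      omega
    exact_mod_cast this
  · linarith

/-- On a component of the set where a piecewise linear function attains its maximum, the order is at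
least the number of directions that leave the component. -/
theorem IsPL.outdeg_le_ord [Fintype E] (hf : Γ.IsPL f) (hM : ∀ p, f p ≤ M) {x p : Γ.Point}
    (hp : p ∈ connectedComponentIn {p | f p = M} x) :
    (Γ.outdeg (connectedComponentIn {p | f p = M} x) p : ℝ) ≤ Γ.ord f p := by
  classical
  cases p with
  | vertex v =>
    simp only [outdeg, ord]
    push_cast
    refine Finset.sum_le_sum fun e _ => ?_
    rw [sub_eq_add_neg]
    refine add_le_add ?_ ?_
    · by_cases hv : Γ.tgt e = v
      · simp only [hv, true_and, if_true]
        have := hf.outward_left_le hM (x := x) e (Γ.len e)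
          (by rwa [Γ.edgePt_of_len_le e le_rfl, hv])
        convert this
      · simp [hv]
    · by_cases hv : Γ.src e = v
      · simp only [hv, true_and, if_true]
        have := hf.outward_right_le hM (x := x) e 0
          (by rwa [Γ.edgePt_of_nonpos e le_rfl, hv])
        convert this
      · simp [hv]
  | inner e t =>
    simp only [outdeg, ord]
    push_cast
    rw [sub_eq_add_neg]
    rw [← Γ.edgePt_of_mem e t.2] at hp
    refine add_le_add ?_ ?_
    · convert hf.outward_left_le hM (x := x) e t hp
    · convert hf.outward_right_le hM (x := x) e t hp

end MaxSet

/-- A `q`-reduced divisor has the largest coefficient at `q` among the effective divisors in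
its class. -/
theorem IsReduced.coeff_le [Finite V] [Fintype E] {q : Γ.Point} {D F : Γ.Divisor}
    (hD : Γ.IsReduced q D) (hF : 0 ≤ F) (h : Γ.LinEquiv D F) : F q ≤ D q := by
  obtain ⟨f, hf, hDF⟩ := h
  obtain ⟨x, -, hx⟩ := isCompact_univ_point.exists_isMaxOn ⟨q, mem_univ q⟩
    hf.continuous.continuousOn
  have hM : ∀ p, f p ≤ f x := fun p => hx (mem_univ p)
  -- Reducedness tests connected sets only, hence one component of the maximum set. There D
  -- dominates F plus the outdegree, which reducedness forbids unless the component contains q.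
  have hge : ∀ p ∈ connectedComponentIn {p | f p = f x} x,
      (Γ.outdeg (connectedComponentIn {p | f p = f x} x) p : ℤ) + F p ≤ D p := by
    intro p hp
    have h1 := hf.outdeg_le_ord hM hp
    rw [← hDF p, Finsupp.sub_apply] at h1
    have : (Γ.outdeg (connectedComponentIn {p | f p = f x} x) p : ℤ) ≤ D p - F p := by
      exact_mod_cast h1
    omega
  have hcl : IsClosed (connectedComponentIn {p | f p = f x} x) := by
    refine isClosed_of_closure_subset ?_
    exact isPreconnected_connectedComponentIn.closure.subset_connectedComponentIn
      (subset_closure (mem_connectedComponentIn rfl))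
      (closure_minimal (connectedComponentIn_subset _ _)
        (isClosed_eq hf.continuous continuous_const))
  by_cases hq : q ∈ connectedComponentIn {p | f p = f x} x
  · have := hge q hq
    omega
  · obtain ⟨p, hp, hlt⟩ := hD.2 _ hcl (isConnected_connectedComponentIn_iff.2 rfl) hq
    have h1 := hge p (hcl.frontier_subset hp)
    have h2 : 0 ≤ F p := hF p
    omega

end MetricGraph

/-! ### Additive functions on divisors and their values on principal divisors. -/

namespace MetricGraph

variable {V E : Type} {Γ : MetricGraph V E} {G H : Type*} [AddCommGroup G] [AddCommGroup H]

/-- The additive extension to divisors of a function on points. -/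
def weight (φ : Γ.Point → G) : Γ.Divisor →+ G :=
  Finsupp.liftAddHom fun p => zmultiplesHom G (φ p)

theorem weight_apply (φ : Γ.Point → G) (D : Γ.Divisor) :
    weight φ D = D.sum fun p n => n • φ p := by
  simp only [weight, Finsupp.liftAddHom_apply]
  rfl

@[simp]
theorem weight_single (φ : Γ.Point → G) (p : Γ.Point) (n : ℤ) :
    weight φ (Finsupp.single p n) = n • φ p := by
  simp [weight]

theorem map_weight (θ : G →+ H) (φ : Γ.Point → G) (D : Γ.Divisor) :
    θ (weight φ D) = weight (fun p => θ (φ p)) D := by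
  simp [weight_apply, Finsupp.sum, map_sum]

theorem weight_congr {φ ψ : Γ.Point → G} {D : Γ.Divisor}
    (h : ∀ p, D p ≠ 0 → φ p = ψ p) : weight φ D = weight ψ D := by
  rw [weight_apply, weight_apply]
  exact Finset.sum_congr rfl fun p hp =>
    congrArg (D p • ·) (h p (Finsupp.mem_support_iff.1 hp))

theorem degree_eq_weight (D : Γ.Divisor) : Γ.degree D = weight (fun _ => (1 : ℤ)) D := by
  simp [degree, weight_apply]

theorem degree_add (D F : Γ.Divisor) : Γ.degree (D + F) = Γ.degree D + Γ.degree F := by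
  simp [degree_eq_weight]

theorem degree_sub (D F : Γ.Divisor) : Γ.degree (D - F) = Γ.degree D - Γ.degree F := by
  simp [degree_eq_weight]

theorem degree_single (p : Γ.Point) (n : ℤ) : Γ.degree (Finsupp.single p n) = n := by
  simp [degree_eq_weight]

/-- The sum of the values, on the divisor of a piecewise linear function, of a function that is
affine on the interior of every edge. -/
theorem weight_principal [Fintype V] [Fintype E] {f : Γ.Point → ℝ} (hf : Γ.IsPL f)
    {Δ : Γ.Divisor} (hΔ : ∀ p, (Δ p : ℝ) = Γ.ord f p) (h : Γ.Point → ℝ) (α β : E → ℝ)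
    (hh : ∀ e (t : Ioo (0 : ℝ) (Γ.len e)), h (.inner e t) = α e + β e * t) :
    weight h Δ = ∑ e, ((h (.vertex (Γ.tgt e)) - α e - β e * Γ.len e) *
        Γ.leftSlope f e (Γ.len e) + (α e - h (.vertex (Γ.src e))) * Γ.rightSlope f e 0 +
        β e * (f (.vertex (Γ.tgt e)) - f (.vertex (Γ.src e)))) := by
  classical
  choose S₀ hS₀ using hf
  -- Break points off the open edge are dropped, so that vertices and break points together give
  -- distinct points of the graph.
  let S : E → Finset ℝ := fun e => (S₀ e).filter (· ∈ Ioo 0 (Γ.len e))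
  have hSmem : ∀ e, ∀ t ∈ S e, t ∈ Ioo 0 (Γ.len e) := fun e t ht => (Finset.mem_filter.1 ht).2
  have hS : ∀ e, ∀ a b : ℝ, 0 ≤ a → a < b → b ≤ Γ.len e → Disjoint (Ioo a b) (S e : Set ℝ) →
      ∃ n : ℤ, ∀ t ∈ Icc a b, f (Γ.edgePt e t) = f (Γ.edgePt e a) + n * (t - a) := by
    intro e a b ha hab hb hd
    refine hS₀ e a b ha hab hb ?_
    rw [Set.disjoint_left] at hd ⊢
    intro t ht hts
    exact hd ht (Finset.mem_coe.2 (Finset.mem_filter.2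
      ⟨hts, ha.trans_lt ht.1, ht.2.trans_le hb⟩))
  let toPt : V ⊕ (Σ _ : E, ℝ) → Γ.Point :=
    Sum.elim Point.vertex fun x => Γ.edgePt x.1 x.2
  let T : Finset (V ⊕ (Σ _ : E, ℝ)) := Finset.univ.disjSum (Finset.univ.sigma S)
  have hinj : Set.InjOn toPt T := by
    rintro (v | ⟨e, t⟩) hx (v' | ⟨e', t'⟩) hy hxy
    · simpa [toPt] using hxy
    · simp only [T, Finset.mem_coe, Finset.inr_mem_disjSum, Finset.mem_sigma, Finset.mem_univ,
        true_and] at hy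
      simp [toPt, Γ.edgePt_of_mem e' (hSmem _ _ hy)] at hxy
    · simp only [T, Finset.mem_coe, Finset.inr_mem_disjSum, Finset.mem_sigma, Finset.mem_univ,
        true_and] at hx
      simp [toPt, Γ.edgePt_of_mem e (hSmem _ _ hx)] at hxy
    · simp only [T, Finset.mem_coe, Finset.inr_mem_disjSum, Finset.mem_sigma, Finset.mem_univ,
        true_and] at hx hy
      simp only [toPt, Sum.elim_inr, Γ.edgePt_of_mem e (hSmem _ _ hx),
        Γ.edgePt_of_mem e' (hSmem _ _ hy), Point.inner.injEq] at hxy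
      obtain ⟨rfl, h2⟩ := hxy
      simpa using h2
  have hsupp : Δ.support ⊆ T.image toPt := by
    intro p hp
    rw [Finsupp.mem_support_iff] at hp
    cases p with
    | vertex v => exact Finset.mem_image.2 ⟨.inl v, by simp [T], rfl⟩
    | inner e t =>
      refine Finset.mem_image.2 ⟨.inr ⟨e, t⟩, ?_, Γ.edgePt_of_mem e t.2⟩
      simp only [T, Finset.inr_mem_disjSum, Finset.mem_sigma, Finset.mem_univ, true_and]
      by_contra hts
      apply hp
      have hzero : Γ.ord f (.inner e t) = 0 := by
        have hcl : IsClosed ((S e : Set ℝ)) := (S e).finite_toSet.isClosed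
        obtain ⟨ε, hε, hball⟩ := Metric.isOpen_iff.1 (hcl.isOpen_compl.inter isOpen_Ioo)
          (t : ℝ) ⟨hts, t.2⟩
        rw [Real.ball_eq_Ioo] at hball
        have hm : ∀ s ∈ Icc ((t : ℝ) - ε / 2) (t + ε / 2), s ∈ Ioo ((t : ℝ) - ε) (t + ε) :=
          fun s hs => ⟨by linarith [hs.1], by linarith [hs.2]⟩
        obtain ⟨n, hn⟩ := hS e (t - ε / 2) (t + ε / 2)
          (hball (hm _ ⟨le_rfl, by linarith⟩)).2.1.le (by linarith)
          (hball (hm _ ⟨by linarith, le_rfl⟩)).2.2.le (by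
            rw [Set.disjoint_left]
            intro s hs
            exact (hball (hm s ⟨hs.1.le, hs.2.le⟩)).1)
        have hl : Γ.leftSlope f e t = n :=
          derivWithin_Iio_of_affine (φ := fun s => f (Γ.edgePt e s)) (a := t - ε / 2)
            (by linarith) fun s hs => hn s ⟨hs.1, by linarith [hs.2]⟩
        have hr : Γ.rightSlope f e t = n :=
          derivWithin_Ioi_of_affine (φ := fun s => f (Γ.edgePt e s)) (b := t + ε / 2)
            (by linarith) fun s hs => by
              rw [hn s ⟨by linarith [hs.1], hs.2⟩, hn t ⟨by linarith, by linarith⟩]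
              ring
        simp only [ord, hl, hr, sub_self]
      have := hΔ (.inner e t)
      rw [hzero] at this
      exact_mod_cast this
  have hedge : ∀ e, ∑ t ∈ S e, Δ (Γ.edgePt e t) • h (Γ.edgePt e t) =
      α e * (Γ.rightSlope f e 0 - Γ.leftSlope f e (Γ.len e)) +
        β e * (f (.vertex (Γ.tgt e)) - f (.vertex (Γ.src e)) -
          Γ.len e * Γ.leftSlope f e (Γ.len e)) := by
    intro e
    have := sum_slope_change_mul_affine (φ := fun t => f (Γ.edgePt e t)) (α e) (β e) (S e)
      (Γ.len e) (Γ.len_pos e) (hSmem e) (hS e)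
    simp only [Γ.edgePt_of_nonpos e le_rfl, Γ.edgePt_of_len_le e le_rfl] at this
    refine Eq.trans ?_ this
    refine Finset.sum_congr rfl fun t ht => ?_
    rw [Γ.edgePt_of_mem e (hSmem e t ht), hh, zsmul_eq_mul, hΔ]
    rfl
  have hvert : ∑ v, Δ (.vertex v) • h (.vertex v) =
      ∑ e, (h (.vertex (Γ.tgt e)) * Γ.leftSlope f e (Γ.len e) -
        h (.vertex (Γ.src e)) * Γ.rightSlope f e 0) := by
    simp only [zsmul_eq_mul, hΔ, ord, Finset.sum_mul]
    rw [Finset.sum_comm]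
    refine Finset.sum_congr rfl fun e _ => ?_
    simp only [sub_mul, ite_mul, zero_mul, Finset.sum_sub_distrib, Finset.sum_ite_eq,
      Finset.mem_univ, if_true]
    ring
  rw [weight_apply, Finsupp.sum_of_support_subset _ hsupp _ (by simp), Finset.sum_image hinj,
    Finset.sum_disjSum, Finset.sum_sigma]
  simp only [toPt, Sum.elim_inl, Sum.elim_inr]
  rw [hvert, Finset.sum_congr rfl fun e _ => hedge e, ← Finset.sum_add_distrib]
  refine Finset.sum_congr rfl fun e _ => ?_
  ring

/-- The constant function 1 has no jumps and no slopes, so every term of `weight_principal`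
vanishes. -/
theorem LinEquiv.degree_eq [Fintype V] [Fintype E] {D D' : Γ.Divisor} (h : Γ.LinEquiv D D') :
    Γ.degree D = Γ.degree D' := by
  obtain ⟨f, hf, hD⟩ := h
  have h1 := weight_principal hf hD (fun _ => 1) (fun _ => 1) (fun _ => 0) (by simp)
  have h2 := map_weight (Int.castAddHom ℝ) (fun _ => (1 : ℤ)) (D - D')
  simp only [Int.coe_castAddHom, Int.cast_one] at h2
  rw [h1, ← degree_eq_weight, degree_sub] at h2
  simp only [sub_self, zero_mul, add_zero, Finset.sum_const_zero, Int.cast_eq_zero] at h2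
  omega

end MetricGraph

/-! ### The Abel–Jacobi map of the chain, with one circle for each loop. -/

namespace ChainOfLoops

open MetricGraph

variable {g : ℕ} (Γ : ChainOfLoops g)

/-- The index of the loop to which a point belongs, a bridge belonging to the loop on its left. -/
def loopIndex : Γ.graph.Point → Fin g
  | .vertex (.inl i) => i
  | .vertex (.inr i) => i
  | .inner (.inl i) _ => i
  | .inner (.inr (.inl i)) _ => i
  | .inner (.inr (.inr i)) _ => ⟨i, by omega⟩

/-- The counterclockwise distance from the right vertex, in the loop to which a point belongs. -/
def loopPos : Γ.graph.Point → ℝ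
  | .vertex (.inl i) => Γ.ℓ i
  | .vertex (.inr _) => 0
  | .inner (.inl _) t => t
  | .inner (.inr (.inl i)) t => Γ.ℓ i + t
  | .inner (.inr (.inr _)) _ => 0

/-- The position of the image of a point under the retraction onto the loop `i`. -/
def retract (i : Fin g) (p : Γ.graph.Point) : ℝ :=
  if Γ.loopIndex p < i then Γ.ℓ i else if Γ.loopIndex p = i then Γ.loopPos p else 0

/-- The component of the Abel–Jacobi map that belongs to the loop `i`. -/
def abelJacobi (i : Fin g) : Γ.graph.Divisor →+ AddCircle (Γ.ℓ i + Γ.m i) :=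
  weight fun p => (Γ.retract i p : AddCircle (Γ.ℓ i + Γ.m i))

/-- The real-valued position is affine on edges and its only jump, from ℓ_i + m_i back to 0, is
where the bottom edge reaches w_i. Summation by parts leaves this jump times an integer slope, a
multiple of the period; the two edges of the loop contribute opposite differences of f, which
cancel. -/
theorem abelJacobi_eq_of_linEquiv {D D' : Γ.graph.Divisor} (h : Γ.graph.LinEquiv D D')
    (i : Fin g) : Γ.abelJacobi i D = Γ.abelJacobi i D' := by
  obtain ⟨f, hf, hD⟩ := h
  rw [← sub_eq_zero, ← map_sub]
  have hw := weight_principal hf hD (Γ.retract i)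
    (Sum.elim (fun k => if k < i then Γ.ℓ i else 0)
      (Sum.elim (fun k => if k ≤ i then Γ.ℓ i else 0)
        fun k => if (k : ℕ) < i then Γ.ℓ i else 0))
    (Sum.elim (fun k => if k = i then 1 else 0) (Sum.elim (fun k => if k = i then 1 else 0) 0)) (by
      rintro (k | k | k) t
      · rcases lt_trichotomy k i with hk | rfl | hk
        · simp [retract, loopIndex, hk, hk.ne]
        · simp [retract, loopIndex, loopPos]
        · simp [retract, loopIndex, hk.not_gt, hk.ne']
      · rcases lt_trichotomy k i with hk | rfl | hk
        · simp [retract, loopIndex, hk, hk.ne, hk.le]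
        · simp [retract, loopIndex, loopPos]
        · simp [retract, loopIndex, hk.not_gt, hk.ne', hk.not_ge]
      · simp only [Sum.elim_inr, Pi.zero_apply, zero_mul, add_zero, retract]
        by_cases h : (k : ℕ) < i
        · rw [if_pos (show Γ.loopIndex (.inner (.inr (.inr k)) t) < i from h), if_pos h]
        · rw [if_neg (show ¬ Γ.loopIndex (.inner (.inr (.inr k)) t) < i from h), if_neg h]
          exact ite_self _)
  obtain ⟨n, hn⟩ := hf.exists_leftSlope_eq (.inr (.inl i)) (Γ.m i)
  have hmap := map_weight (QuotientAddGroup.mk' (AddSubgroup.zmultiples (Γ.ℓ i + Γ.m i)))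
    (Γ.retract i) (D - D')
  have hval : weight (Γ.retract i) (D - D') = -((Γ.ℓ i + Γ.m i) * n) := by
    rw [hw, Fintype.sum_sum_type, Fintype.sum_sum_type, ← add_assoc, ← Finset.sum_add_distrib,
      Finset.sum_eq_single i, Finset.sum_eq_zero, ← hn]
    · simp [retract, loopIndex, loopPos, graph]
      ring
    · rintro k -
      simp only [graph, Sum.elim_inr, retract, loopIndex, loopPos, Fin.lt_def, Fin.ext_iff,
        Pi.zero_apply]
      have hℓ : (k : ℕ) + 1 = i → Γ.ℓ ⟨k + 1, by omega⟩ = Γ.ℓ i := fun h =>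
        congrArg Γ.ℓ (Fin.ext h)
      split_ifs <;> first | omega | (simp; done) | simp [hℓ (by omega)]
    · rintro k - hk
      rcases lt_or_gt_of_ne hk with hk | hk
      · simp [retract, loopIndex, hk, hk.ne, hk.le, graph]
      · simp [retract, loopIndex, hk.not_gt, hk.ne', hk.not_ge, graph]
    · simp
  refine hmap.symm.trans ?_
  rw [hval]
  exact (AddCircle.coe_eq_zero_iff _).2 ⟨-n, by simp; ring⟩

end ChainOfLoops

/-! ### Rectangular tableaux as column functions. -/

namespace RectTableau

variable {s c n : ℕ}

theorem col_entry (T : RectTableau s c n) (a : Fin s) (b : Fin c) : T.col (T.entry a b) = b :=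
  congrArg Prod.snd ((Equiv.ofBijective _ T.bijective).symm_apply_apply (a, b))

theorem exists_entry_eq (T : RectTableau s c n) (i : Fin n) : ∃ a, T.entry a (T.col i) = i :=
  ⟨_, (Equiv.ofBijective _ T.bijective).apply_symm_apply i⟩

theorem range_entry (T : RectTableau s c n) (b : Fin c) :
    range (fun a => T.entry a b) = {i | T.col i = b} := by
  ext i
  constructor
  · rintro ⟨a, rfl⟩
    exact T.col_entry a b
  · rintro rfl
    exact T.exists_entry_eq i

/-- A strictly increasing column is determined by its set of entries, a fibre of `col`. -/
theorem eq_of_col_eq {T T' : RectTableau s c n} (h : ∀ i, T.col i = T'.col i) : T = T' := by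
  have he : T.entry = T'.entry := by
    funext a b
    have : (fun a => T.entry a b) = fun a => T'.entry a b :=
      ((T.col_strictMono b).range_inj (T'.col_strictMono b)).1 (by
        simp only [range_entry, h])
    exact congrFun this a
  cases T
  cases T'
  cases he
  rfl

/-- A colouring whose fibres all have `s` elements and whose initial segments have weakly decreasing
fibres is the column function of a rectangular tableau. -/
theorem exists_of_col (col : Fin n → Fin c)
    (hcard : ∀ b, (Finset.univ.filter fun i => col i = b).card = s)
    (hdom : ∀ k : ℕ, ∀ b b' : Fin c, b < b' →
      (Finset.univ.filter fun i : Fin n => (i : ℕ) < k ∧ col i = b').card ≤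
        (Finset.univ.filter fun i : Fin n => (i : ℕ) < k ∧ col i = b).card) :
    ∃ T : RectTableau s c n, ∀ i, T.col i = col i := by
  classical
  let entry : Fin s → Fin c → Fin n := fun a b =>
    (Finset.univ.filter fun i => col i = b).orderEmbOfFin (hcard b) a
  have hcol : ∀ a b, col (entry a b) = b := fun a b =>
    (Finset.mem_filter.1 (Finset.orderEmbOfFin_mem _ (hcard b) a)).2
  have hmono : ∀ b, StrictMono fun a => entry a b := fun b =>
    ((Finset.univ.filter fun i => col i = b).orderEmbOfFin (hcard b)).strictMono
  have hsurj : ∀ i, ∃ a, entry a (col i) = i := fun i => by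
    have : i ∈ range ((Finset.univ.filter fun i' => col i' = col i).orderEmbOfFin
        (hcard (col i))) := by
      rw [Finset.range_orderEmbOfFin]
      simp
    exact this
  suffices hT : Function.Bijective (fun x : Fin s × Fin c => entry x.1 x.2) ∧
      ∀ a, StrictMono (entry a) by
    refine ⟨⟨entry, hT.1, hT.2, hmono⟩, fun i => ?_⟩
    obtain ⟨a, ha⟩ := hsurj i
    have := col_entry (⟨entry, hT.1, hT.2, hmono⟩ : RectTableau s c n) a (col i)
    rwa [show (RectTableau.mk entry hT.1 hT.2 hmono).entry a (col i) = i from ha] at this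
  refine ⟨⟨?_, ?_⟩, ?_⟩
  · rintro ⟨a, b⟩ ⟨a', b'⟩ h
    simp only at h
    have hb : b = b' := by rw [← hcol a b, h, hcol]
    subst hb
    rw [(hmono b).injective h]
  · intro i
    obtain ⟨a, ha⟩ := hsurj i
    exact ⟨(a, col i), ha⟩
  · intro a b b' hbb
    by_contra! hle
    -- Cut just after the entry of row a in column b'. By then column b' has received at least a + 1
    -- entries, and column b, if its row a entry is not smaller, at most a.
    have h := hdom (entry a b' + 1) b b' hbb
    have h1 : (Finset.Iic a).card ≤ (Finset.univ.filter fun i : Fin n =>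
        (i : ℕ) < entry a b' + 1 ∧ col i = b').card := by
      refine Finset.card_le_card_of_injOn (fun x => entry x b') (fun x hx => ?_)
        (hmono b').injective.injOn
      have : entry x b' ≤ entry a b' := (hmono b').monotone (Finset.mem_Iic.1 hx)
      simp [hcol, this]
    have h2 : (Finset.univ.filter fun i : Fin n =>
        (i : ℕ) < entry a b' + 1 ∧ col i = b).card ≤ (Finset.Iio a).card := by
      refine (Finset.card_le_card (t := (Finset.Iio a).image fun x => entry x b) ?_).trans
        Finset.card_image_le
      intro i hi
      obtain ⟨-, hi1, rfl⟩ := Finset.mem_filter.1 hi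
      obtain ⟨x, hx⟩ := hsurj i
      refine Finset.mem_image.2 ⟨x, Finset.mem_Iio.2 ?_, hx⟩
      have hne : i ≠ entry a b' := fun h => by
        have := hcol a b'
        rw [← h] at this
        exact hbb.ne this
      have hlt : entry x (col i) < entry a (col i) := by
        rw [hx]
        exact (lt_of_le_of_ne (Fin.le_def.2 (Nat.lt_succ_iff.1 hi1)) hne).trans_le hle
      exact (hmono _).lt_iff_lt.1 hlt
    simp only [Fin.card_Iic, Fin.card_Iio] at h1 h2
    omega

end RectTableau

/-! ### Combinatorics of the lower bounds. -/

/-- The lower bounds for the degrees to the left of the successive loops: a bound grows by one at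
each loop, except that it lingers at the values selected by `L`, unless this would make it equal to
the preceding bound. -/
def lingerSeq (L : ℕ → ℤ → Prop) : ℕ → ℕ → ℤ
  | 0, k => k
  | i + 1, k =>
      open Classical in
      if L i (lingerSeq L i k) ∧ (k = 0 ∨ lingerSeq L i (k - 1) + 1 ≠ lingerSeq L i k)
      then lingerSeq L i k else lingerSeq L i k + 1

namespace lingerSeq

variable (L : ℕ → ℤ → Prop)

theorem succ_of_linger {i k : ℕ} (h : L i (lingerSeq L i k))
    (h' : k = 0 ∨ lingerSeq L i (k - 1) + 1 ≠ lingerSeq L i k) :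
    lingerSeq L (i + 1) k = lingerSeq L i k := by
  rw [lingerSeq, if_pos ⟨h, h'⟩]

theorem succ_of_not {i k : ℕ} (h : ¬ (L i (lingerSeq L i k) ∧
    (k = 0 ∨ lingerSeq L i (k - 1) + 1 ≠ lingerSeq L i k))) :
    lingerSeq L (i + 1) k = lingerSeq L i k + 1 := by
  rw [lingerSeq, if_neg h]

theorem succ_eq_or (i k : ℕ) :
    lingerSeq L (i + 1) k = lingerSeq L i k ∨ lingerSeq L (i + 1) k = lingerSeq L i k + 1 := by
  rw [lingerSeq]
  split_ifs <;> simp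

theorem linger_of_succ_eq {i k : ℕ} (h : lingerSeq L (i + 1) k = lingerSeq L i k) :
    L i (lingerSeq L i k) ∧ (k = 0 ∨ lingerSeq L i (k - 1) + 1 ≠ lingerSeq L i k) := by
  by_contra hn
  rw [succ_of_not L hn] at h
  omega

theorem monotone_left (k : ℕ) : Monotone fun i => lingerSeq L i k :=
  monotone_nat_of_le_succ fun i => by
    rcases succ_eq_or L i k with h | h <;> simp [h]

/-- The gap below a bound shrinks only when this bound lingers and the preceding one moves; the
second condition in `lingerSeq` forbids lingering across a gap of 1. -/
theorem strictMono (i : ℕ) : StrictMono (lingerSeq L i) := by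
  induction i with
  | zero => intro a b h; simpa [lingerSeq] using h
  | succ i ih =>
    refine strictMono_nat_of_lt_succ fun k => ?_
    have h0 := ih (Nat.lt_add_one k)
    rcases succ_eq_or L i (k + 1) with h | h
    · have h1 := (linger_of_succ_eq L h).2
      simp only [Nat.add_eq_zero_iff, one_ne_zero, and_false, Nat.add_sub_cancel, false_or] at h1
      rcases succ_eq_or L i k with h2 | h2 <;> omega
    · rcases succ_eq_or L i k with h2 | h2 <;> omega

theorem nonneg (i k : ℕ) : 0 ≤ lingerSeq L i k :=
  le_trans (by simp [lingerSeq]) (monotone_left L k (Nat.zero_le i))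

theorem eq_add_sub_card (n k : ℕ) : lingerSeq L n k = k + n -
    ((Finset.range n).filter fun i => lingerSeq L (i + 1) k = lingerSeq L i k).card := by
  induction n with
  | zero => rw [Finset.range_zero, Finset.filter_empty]; simp [lingerSeq]
  | succ n ih =>
    rw [Finset.range_add_one, Finset.filter_insert]
    split_ifs with h
    · rw [Finset.card_insert_of_notMem (by simp), h, ih]
      push_cast
      ring
    · rw [(succ_eq_or L n k).resolve_left h, ih]
      push_cast
      ring

/-- If the total growth of the bounds is as small as possible, then exactly one bound lingers
at every loop. -/
theorem exists_col {g r s : ℕ} (hg : (r + 1) * s = g)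
    (hbound : ∀ k ≤ r, lingerSeq L g k + s ≤ k + g)
    (huniq : ∀ i < g, ∀ k ≤ r, ∀ k' ≤ r, L i (lingerSeq L i k) → L i (lingerSeq L i k') →
      k = k') :
    ∃ col : Fin g → Fin (r + 1),
      (∀ (i : Fin g) (k : Fin (r + 1)),
        lingerSeq L (i + 1) k = lingerSeq L i k + if col i = k then 0 else 1) ∧
      ∀ b, (Finset.univ.filter fun i => col i = b).card = s := by
  classical
  let still : Fin g → Fin (r + 1) → Prop := fun i k =>
    lingerSeq L (i + 1) k = lingerSeq L i k
  have hcount : ∀ k : Fin (r + 1), ((Finset.range g).filter fun i =>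
      lingerSeq L (i + 1) k = lingerSeq L i k).card =
      (Finset.univ.filter fun i => still i k).card := by
    intro k
    rw [Finset.card_filter, Finset.card_filter, Finset.sum_range]
  have hge : ∀ k : Fin (r + 1), s ≤ (Finset.univ.filter fun i => still i k).card := by
    intro k
    have h1 := hbound k (Nat.lt_succ_iff.1 k.2)
    rw [eq_add_sub_card, hcount] at h1
    omega
  have hle : ∀ i, (Finset.univ.filter fun k => still i k).card ≤ 1 := by
    intro i
    refine Finset.card_le_one.2 fun k hk k' hk' => Fin.ext ?_
    exact huniq i i.2 k (Nat.lt_succ_iff.1 k.2) k' (Nat.lt_succ_iff.1 k'.2)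
      (linger_of_succ_eq L (Finset.mem_filter.1 hk).2).1
      (linger_of_succ_eq L (Finset.mem_filter.1 hk').2).1
  -- Double counting: at least s lingerings for each of the r + 1 bounds and at most one for each of
  -- the g loops. As (r + 1) s = g, equality holds throughout.
  have hcomm : ∑ k, (Finset.univ.filter fun i => still i k).card =
      ∑ i, (Finset.univ.filter fun k => still i k).card := by
    simp only [Finset.card_filter]
    exact Finset.sum_comm
  have hsum1 : ∑ _k : Fin (r + 1), s = g := by simpa using hg
  have hsum2 : ∑ _i : Fin g, 1 = g := by simp
  have h1 : ∑ k : Fin (r + 1), s ≤ ∑ k, (Finset.univ.filter fun i => still i k).card :=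
    Finset.sum_le_sum fun k _ => hge k
  have h2 : ∑ i, (Finset.univ.filter fun k => still i k).card ≤ ∑ _i : Fin g, 1 :=
    Finset.sum_le_sum fun i _ => hle i
  have heq1 := (Finset.sum_eq_sum_iff_of_le (s := Finset.univ) fun k _ => hge k).1 (by omega)
  have heq2 := (Finset.sum_eq_sum_iff_of_le (s := Finset.univ) fun i _ => hle i).1 (by omega)
  have hex : ∀ i, ∃ k, ∀ k', still i k' ↔ k = k' := by
    intro i
    obtain ⟨k, hk⟩ := Finset.card_eq_one.1 (heq2 i (Finset.mem_univ i))
    refine ⟨k, fun k' => ?_⟩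
    have : k' ∈ (Finset.univ.filter fun k => still i k) ↔ k' ∈ ({k} : Finset _) := by rw [hk]
    simpa [eq_comm] using this
  choose col hcol using hex
  refine ⟨col, fun i k => ?_, fun b => ?_⟩
  · split_ifs with h
    · rw [add_zero]
      exact (hcol i k).2 h
    · exact (succ_eq_or L i k).resolve_left fun h' => h ((hcol i k).1 h')
  · rw [heq1 b (Finset.mem_univ b)]
    exact congrArg _ (Finset.filter_congr fun i _ => (hcol i b).symm)

theorem eq_add_sub_card_col {g r : ℕ} {col : Fin g → Fin (r + 1)}
    (h : ∀ (i : Fin g) (k : Fin (r + 1)),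
      lingerSeq L (i + 1) k = lingerSeq L i k + if col i = k then 0 else 1)
    {n : ℕ} (hn : n ≤ g) (k : Fin (r + 1)) : lingerSeq L n k = k + n -
      (Finset.univ.filter fun i : Fin g => (i : ℕ) < n ∧ col i = k).card := by
  rw [eq_add_sub_card]
  congr 2
  refine (Finset.card_bij (fun (i : Fin g) _ => (i : ℕ)) ?_ (fun _ _ _ _ h => Fin.ext h) ?_).symm
  · intro i hi
    obtain ⟨-, hin, hk⟩ := Finset.mem_filter.1 hi
    simp [hin, h i k, hk]
  · intro i hi
    obtain ⟨hin, hk⟩ := Finset.mem_filter.1 hi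
    have hig : i < g := (Finset.mem_range.1 hin).trans_le hn
    have := h ⟨i, hig⟩ k
    simp only [hk] at this
    refine ⟨⟨i, hig⟩, ?_, rfl⟩
    simp only [Finset.mem_filter, Finset.mem_univ, true_and]
    refine ⟨Finset.mem_range.1 hin, ?_⟩
    by_contra hne
    simp [hne] at this

end lingerSeq

/-! ### Left degrees, genericity, and the bounds forced by the rank. -/

namespace ChainOfLoops

open MetricGraph

variable {g : ℕ} (Γ : ChainOfLoops g)

open Classical in
/-- The leftmost vertex has zone `0`; the rest of the loop `i` and the bridge on its right have
zone `i + 1`. -/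
def zone (p : Γ.graph.Point) : ℕ := if p = Γ.vFirst then 0 else Γ.loopIndex p + 1

/-- The degree of a divisor on the zones up to `i`. -/
def leftDeg (i : ℕ) : Γ.graph.Divisor →+ ℤ := weight fun p => if Γ.zone p ≤ i then 1 else 0

theorem zone_vFirst : Γ.zone Γ.vFirst = 0 := by simp [zone]

theorem zone_of_ne {p : Γ.graph.Point} (h : p ≠ Γ.vFirst) : Γ.zone p = Γ.loopIndex p + 1 := by
  simp [zone, h]

theorem zone_le (p : Γ.graph.Point) : Γ.zone p ≤ g := by
  rw [zone]
  split_ifs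
  · exact Nat.zero_le _
  · exact (Γ.loopIndex p).2

theorem zone_w (i : Fin g) : Γ.zone (Γ.w i) = i + 1 :=
  Γ.zone_of_ne (by simp [w, vFirst, v])

theorem retract_vFirst (i : Fin g) : Γ.retract i Γ.vFirst = Γ.ℓ i := by
  rw [retract]
  split_ifs with h1 h2
  · rfl
  · rw [← h2]
    rfl
  · exact absurd (lt_of_le_of_ne (Fin.le_def.2 (Nat.zero_le _)) h2) h1

theorem retract_w (i : Fin g) : Γ.retract i (Γ.w i) = 0 := by
  simp [retract, loopIndex, w, loopPos]

theorem retract_wLast (i : Fin g) : Γ.retract i Γ.wLast = 0 := by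
  have h : ¬ Γ.loopIndex Γ.wLast < i := by
    change ¬ (g - 1 < (i : ℕ))
    omega
  rw [retract, if_neg h]
  exact ite_self _

theorem retract_of_zone_le {i : Fin g} {p : Γ.graph.Point} (h : Γ.zone p ≤ i) :
    Γ.retract i p = Γ.ℓ i := by
  by_cases hp : p = Γ.vFirst
  · rw [hp, retract_vFirst]
  · rw [zone_of_ne _ hp] at h
    rw [retract, if_pos (Fin.lt_def.2 (by omega))]

theorem retract_of_lt_zone {i : Fin g} {p : Γ.graph.Point} (h : i + 1 < Γ.zone p) :
    Γ.retract i p = 0 := by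
  by_cases hp : p = Γ.vFirst
  · rw [hp, zone_vFirst] at h
    omega
  · rw [zone_of_ne _ hp] at h
    rw [retract, if_neg (by rw [Fin.lt_def]; omega), if_neg (by rw [Fin.ext_iff]; omega)]

theorem leftDeg_single (i : ℕ) (p : Γ.graph.Point) (n : ℤ) :
    Γ.leftDeg i (Finsupp.single p n) = if Γ.zone p ≤ i then n else 0 := by
  simp [leftDeg]

theorem leftDeg_zero (F : Γ.graph.Divisor) : Γ.leftDeg 0 F = F Γ.vFirst := by
  rw [leftDeg, weight_apply, Finsupp.sum, Finset.sum_eq_single Γ.vFirst]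
  · simp [zone_vFirst]
  · intro p _ hp
    simp [zone_of_ne _ hp]
  · intro h
    simp [Finsupp.notMem_support_iff.1 h]

theorem leftDeg_last (F : Γ.graph.Divisor) : Γ.leftDeg g F = Γ.graph.degree F := by
  rw [degree_eq_weight]
  exact weight_congr fun p _ => if_pos (Γ.zone_le p)

variable {Γ}

theorem leftDeg_le_succ {F : Γ.graph.Divisor} (hF : 0 ≤ F) (i : ℕ) :
    Γ.leftDeg i F ≤ Γ.leftDeg (i + 1) F := by
  rw [leftDeg, leftDeg, weight_apply, weight_apply]
  refine Finset.sum_le_sum fun p _ => mul_le_mul_of_nonneg_left ?_ (hF p)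
  split_ifs <;> omega

theorem sub_single_nonneg {F : Γ.graph.Divisor} (hF : 0 ≤ F) {p : Γ.graph.Point} {n : ℤ}
    (hn : n ≤ F p) : 0 ≤ F - Finsupp.single p n := by
  classical
  intro q
  have := hF q
  simp only [Finsupp.coe_zero, Pi.zero_apply, Finsupp.sub_apply, Finsupp.single_apply] at this ⊢
  split_ifs with h
  · subst h
    omega
  · omega

theorem leftDeg_add_coeff_le {F : Γ.graph.Divisor} (hF : 0 ≤ F) {i : ℕ} {p : Γ.graph.Point}
    (hp : Γ.zone p = i + 1) : Γ.leftDeg i F + F p ≤ Γ.leftDeg (i + 1) F := by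
  have := leftDeg_le_succ (sub_single_nonneg hF (p := p) le_rfl) i
  rw [map_sub, map_sub, leftDeg_single, leftDeg_single, hp, if_neg (by omega),
    if_pos le_rfl] at this
  omega

theorem coeff_eq_zero_of_leftDeg_eq {F : Γ.graph.Divisor} (hF : 0 ≤ F) {i : ℕ}
    (h : Γ.leftDeg (i + 1) F = Γ.leftDeg i F) {p : Γ.graph.Point} (hp : Γ.zone p = i + 1) :
    F p = 0 := by
  have h1 := leftDeg_add_coeff_le hF hp
  have h2 : 0 ≤ F p := hF p
  omega

/-- With zone i + 1 empty, every point retracts either to the left vertex, at position ℓ_i, or to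
the right vertex, at position 0. -/
theorem abelJacobi_of_leftDeg_eq {F : Γ.graph.Divisor} (hF : 0 ≤ F) {i : Fin g}
    (h : Γ.leftDeg (i + 1) F = Γ.leftDeg i F) :
    Γ.abelJacobi i F = Γ.leftDeg i F • (Γ.ℓ i : AddCircle (Γ.ℓ i + Γ.m i)) := by
  have hmap := map_weight ((zmultiplesHom (AddCircle (Γ.ℓ i + Γ.m i))) (Γ.ℓ i))
    (fun p => if Γ.zone p ≤ i then (1 : ℤ) else 0) F
  refine Eq.trans ?_ hmap.symm
  refine weight_congr fun p hp => ?_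
  rcases lt_trichotomy (Γ.zone p) (i + 1) with hz | hz | hz
  · simp [retract_of_zone_le Γ (Nat.lt_succ_iff.1 hz), Nat.lt_succ_iff.1 hz]
  · exact absurd (coeff_eq_zero_of_leftDeg_eq hF h hz) hp
  · have : ¬ Γ.zone p ≤ i := by omega
    simp [retract_of_lt_zone Γ hz, this]

theorem exists_zone_eq_of_leftDeg_ne {F : Γ.graph.Divisor} {i : ℕ}
    (h : Γ.leftDeg (i + 1) F ≠ Γ.leftDeg i F) : ∃ p, Γ.zone p = i + 1 ∧ F p ≠ 0 := by
  by_contra! hn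
  refine h (weight_congr fun p hp => ?_)
  have : Γ.zone p ≠ i + 1 := fun hz => hp (hn p hz)
  split_ifs <;> omega

theorem abelJacobi_single (i : Fin g) (p : Γ.graph.Point) (n : ℤ) :
    Γ.abelJacobi i (Finsupp.single p n) = n • (Γ.retract i p : AddCircle (Γ.ℓ i + Γ.m i)) :=
  weight_single _ _ _

theorem coe_ℓ_add_coe_m (i : Fin g) :
    (Γ.ℓ i : AddCircle (Γ.ℓ i + Γ.m i)) + (Γ.m i : AddCircle (Γ.ℓ i + Γ.m i)) = 0 := by
  rw [← AddCircle.coe_add, AddCircle.coe_period]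

theorem coe_ℓ_ne_zero (i : Fin g) : (Γ.ℓ i : AddCircle (Γ.ℓ i + Γ.m i)) ≠ 0 := by
  rw [Ne, AddCircle.coe_eq_zero_iff]
  rintro ⟨n, hn⟩
  have hℓ := Γ.ℓ_pos i
  have hm := Γ.m_pos i
  rw [zsmul_eq_mul] at hn
  have h0 : (0 : ℝ) < n := by
    by_contra! h
    nlinarith
  have h1 : (1 : ℝ) ≤ n := by
    have : (0 : ℤ) < n := by exact_mod_cast h0
    exact_mod_cast this
  nlinarith

/-- A relation n ℓ = k (ℓ + m) gives ℓ / m = k / (n - k), a ratio of positive integers with sum n.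
-/
theorem IsGeneric.zsmul_ne_zero (hΓ : Γ.IsGeneric) (i : Fin g) {n : ℤ} (hn : 0 < n)
    (hn' : n + 2 ≤ 2 * g) : n • (Γ.ℓ i : AddCircle (Γ.ℓ i + Γ.m i)) ≠ 0 := by
  rw [← AddCircle.coe_zsmul, Ne, AddCircle.coe_eq_zero_iff]
  rintro ⟨k, hk⟩
  have hℓ := Γ.ℓ_pos i
  have hm := Γ.m_pos i
  rw [zsmul_eq_mul, zsmul_eq_mul] at hk
  have hn0 : (0 : ℝ) < n := by exact_mod_cast hn
  have hk0 : 0 < k := by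
    by_contra! h
    have : (k : ℝ) ≤ 0 := by exact_mod_cast h
    nlinarith [mul_pos hn0 hℓ]
  have hk0' : (0 : ℝ) < k := by exact_mod_cast hk0
  have hkn : k < n := by
    by_contra! h
    have : (n : ℝ) ≤ k := by exact_mod_cast h
    nlinarith [mul_pos hk0' hm]
  obtain ⟨a, rfl⟩ := Int.eq_ofNat_of_zero_le hk0.le
  obtain ⟨b, hb⟩ := Int.eq_ofNat_of_zero_le (sub_pos.2 hkn).le
  have hnab : n = a + b := by omega
  subst hnab
  refine hΓ i a b (by omega) (by omega) (by omega) ?_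
  have hb0 : (0 : ℝ) < b := by
    have : 0 < b := by omega
    exact_mod_cast this
  rw [div_eq_div_iff hm.ne' hb0.ne']
  push_cast at hk
  linarith

theorem IsGeneric.zsmul_inj (hΓ : Γ.IsGeneric) (i : Fin g) {a b c : ℤ} (ha : 0 ≤ a) (hac : a ≤ c)
    (hb : 0 ≤ b) (hbc : b ≤ c) (hc : c + 2 ≤ 2 * g)
    (h : a • (Γ.ℓ i : AddCircle (Γ.ℓ i + Γ.m i)) = b • (Γ.ℓ i : AddCircle (Γ.ℓ i + Γ.m i))) :
    a = b := by
  rcases lt_trichotomy a b with hab | hab | hab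
  · refine absurd ?_ (hΓ.zsmul_ne_zero i (n := b - a) (by omega) (by omega))
    rw [sub_smul, h, sub_self]
  · exact hab
  · refine absurd ?_ (hΓ.zsmul_ne_zero i (n := a - b) (by omega) (by omega))
    rw [sub_smul, h, sub_self]

variable (Γ)

/-- A degree `a` to the left of the loop `i` is lingering for `D` if the divisors in the class
of `D` with this degree may have no point on the loop. -/
def Lingers (D : Γ.graph.Divisor) (i : ℕ) (a : ℤ) : Prop :=
  ∃ h : i < g, a • (Γ.ℓ ⟨i, h⟩ : AddCircle (Γ.ℓ ⟨i, h⟩ + Γ.m ⟨i, h⟩)) = Γ.abelJacobi ⟨i, h⟩ D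

variable {Γ} {D : Γ.graph.Divisor}

theorem lingers_of_leftDeg_eq {F : Γ.graph.Divisor} (hF : 0 ≤ F) {i : Fin g}
    (hAJ : Γ.abelJacobi i F = Γ.abelJacobi i D)
    (h : Γ.leftDeg (i + 1) F = Γ.leftDeg i F) : Γ.Lingers D i (Γ.leftDeg i F) :=
  ⟨i.2, by rw [← hAJ, ← abelJacobi_of_leftDeg_eq hF h]⟩

/-- The forcing divisor starts as k v_1. It changes only where the bound k is at the lingering value
but just above the bound k - 1: there the divisor for k - 1 is used, with w_i added. -/
theorem exists_forcing (D : Γ.graph.Divisor) {i : ℕ} (hi : i ≤ g) : ∀ k : ℕ,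
    ∃ A : Γ.graph.Divisor, 0 ≤ A ∧ Γ.graph.degree A = k ∧ ∀ F, A ≤ F →
      (∀ i, Γ.abelJacobi i F = Γ.abelJacobi i D) →
        lingerSeq (Γ.Lingers D) i k ≤ Γ.leftDeg i F := by
  induction i with
  | zero =>
    intro k
    refine ⟨Finsupp.single Γ.vFirst k, ?_, degree_single _ _, fun F hF _ => ?_⟩
    · exact Finsupp.single_nonneg.2 (Int.natCast_nonneg k)
    · have := hF Γ.vFirst
      rwa [Finsupp.single_eq_same, ← leftDeg_zero] at this
  | succ i ih =>
    intro k
    have hig : i < g := hi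
    have ih := ih hig.le
    by_cases hL : Γ.Lingers D i (lingerSeq (Γ.Lingers D) i k)
    · by_cases hk : k = 0 ∨ lingerSeq (Γ.Lingers D) i (k - 1) + 1 ≠ lingerSeq (Γ.Lingers D) i k
      · obtain ⟨A, hA, hdeg, h⟩ := ih k
        refine ⟨A, hA, hdeg, fun F hAF hAJ => ?_⟩
        rw [lingerSeq.succ_of_linger _ hL hk]
        exact (h F hAF hAJ).trans (leftDeg_le_succ (hA.trans hAF) i)
      · push Not at hk
        obtain ⟨A, hA, hdeg, h⟩ := ih (k - 1)
        have hs : (0 : Γ.graph.Divisor) ≤ Finsupp.single (Γ.w ⟨i, hig⟩) 1 :=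
          Finsupp.single_nonneg.2 zero_le_one
        refine ⟨A + Finsupp.single (Γ.w ⟨i, hig⟩) 1, add_nonneg hA hs, ?_, fun F hAF hAJ => ?_⟩
        · rw [degree_add, degree_single, hdeg]
          omega
        rw [lingerSeq.succ_of_not _ (by push Not; exact fun _ => hk)]
        have hF' : 0 ≤ F - Finsupp.single (Γ.w ⟨i, hig⟩) 1 :=
          sub_nonneg.2 ((le_add_of_nonneg_left hA).trans hAF)
        have h1 := h F ((le_add_of_nonneg_right hs).trans hAF) hAJ
        have h2 := leftDeg_le_succ hF' i
        have h3 : Γ.leftDeg i (F - Finsupp.single (Γ.w ⟨i, hig⟩) 1) = Γ.leftDeg i F := by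
          rw [map_sub, leftDeg_single, zone_w, if_neg (by simp), sub_zero]
        have h4 : Γ.leftDeg (i + 1) (F - Finsupp.single (Γ.w ⟨i, hig⟩) 1) =
            Γ.leftDeg (i + 1) F - 1 := by
          rw [map_sub, leftDeg_single, zone_w, if_pos le_rfl]
        -- If the bound failed, F - w_i would have no point in zone i + 1 and left degree one less
        -- than the lingering value. Its component, unchanged by removing w_i, would give ℓ_i = 0 on
        -- the circle.
        by_contra! hlt
        have h5 := abelJacobi_of_leftDeg_eq hF' (i := ⟨i, hig⟩) (by
          change Γ.leftDeg (i + 1) _ = Γ.leftDeg i _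
          omega)
        obtain ⟨_, hL⟩ := hL
        rw [map_sub, abelJacobi_single, retract_w, AddCircle.coe_zero, smul_zero, sub_zero, hAJ,
          ← hL, h3, show Γ.leftDeg i F = lingerSeq (Γ.Lingers D) i k - 1 by omega, sub_smul,
          one_smul, eq_comm, sub_eq_self] at h5
        exact coe_ℓ_ne_zero _ h5
    · obtain ⟨A, hA, hdeg, h⟩ := ih k
      refine ⟨A, hA, hdeg, fun F hAF hAJ => ?_⟩
      have hF := hA.trans hAF
      rw [lingerSeq.succ_of_not _ fun h => hL h.1]
      have h1 := h F hAF hAJ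
      have h2 := leftDeg_le_succ hF i
      by_contra! hlt
      refine hL ?_
      rw [show lingerSeq (Γ.Lingers D) i k = Γ.leftDeg i F by omega]
      exact lingers_of_leftDeg_eq hF (i := ⟨i, hig⟩) (hAJ _) (by
        change Γ.leftDeg (i + 1) _ = Γ.leftDeg i _
        omega)

/-- The degree r - k not used for forcing is spent at w_g, which has position 0 on every loop.
Removing these points keeps all Abel–Jacobi components and lowers the degree by r - k. -/
theorem lingerSeq_last_le {r : ℕ} (hrank : Γ.graph.RankAtLeast D r) {k : ℕ} (hk : k ≤ r) :
    lingerSeq (Γ.Lingers D) g k + r ≤ Γ.graph.degree D + k := by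
  obtain ⟨A, hA, hdeg, h⟩ := exists_forcing D le_rfl k
  obtain ⟨F, hF, hDF⟩ := hrank (A + Finsupp.single Γ.wLast ((r : ℤ) - k))
    (add_nonneg hA (Finsupp.single_nonneg.2 (by omega)))
    (by rw [degree_add, degree_single, hdeg]; ring)
  have h1 := h (F + A) (le_add_of_nonneg_left hF) (fun i => by
    have := Γ.abelJacobi_eq_of_linEquiv hDF i
    rw [map_sub, map_add, abelJacobi_single, retract_wLast, AddCircle.coe_zero, smul_zero,
      add_zero] at this
    rw [map_add, ← this, sub_add_cancel])
  have h2 := hDF.degree_eq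
  rw [degree_sub, degree_add, degree_single] at h2
  rw [leftDeg_last, degree_add] at h1
  omega

/-! ### Points of a loop and their positions. -/

/-- The point of a zone at a given nonzero position of its loop. -/
theorem loopPt_eq_of_retract {i : Fin g} {p : Γ.graph.Point} (hp : Γ.zone p = i + 1) {x : ℝ}
    (hx : (x : AddCircle (Γ.ℓ i + Γ.m i)) = Γ.retract i p)
    (hx0 : (x : AddCircle (Γ.ℓ i + Γ.m i)) ≠ 0) : Γ.loopPt i x = p := by
  have hℓ := Γ.ℓ_pos i
  have hm := Γ.m_pos i
  have hne : p ≠ Γ.vFirst := fun h => by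
    rw [h, zone_vFirst] at hp
    omega
  have hidx : Γ.loopIndex p = i := by
    rw [zone_of_ne _ hne] at hp
    exact Fin.ext (by omega)
  have hret : Γ.retract i p = Γ.loopPos p := by
    rw [retract, if_neg (by rw [hidx]; exact lt_irrefl i), if_pos hidx]
  rw [hret] at hx
  have hmod : ∀ y : ℝ, (x : AddCircle (Γ.ℓ i + Γ.m i)) = y → 0 ≤ y → y < Γ.ℓ i + Γ.m i →
      toIcoMod (add_pos hℓ hm) 0 x = y := by
    intro y hxy h0 h1
    have h2 : toIcoMod (add_pos hℓ hm) 0 y = y :=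
      (toIcoMod_eq_self _).2 ⟨h0, by simpa using h1⟩
    rw [← h2]
    refine (toIcoMod_eq_toIcoMod _).2 ?_
    obtain ⟨n, hn⟩ := (AddCircle.coe_eq_zero_iff (Γ.ℓ i + Γ.m i) (x := y - x)).1
      (by rw [AddCircle.coe_sub, hxy, sub_self])
    exact ⟨n, hn.symm⟩
  have hx0' : (Γ.loopPos p : AddCircle (Γ.ℓ i + Γ.m i)) ≠ 0 := hx ▸ hx0
  rcases p with (k | k) | (k | k | k)
  · obtain rfl : k = i := hidx
    have := hmod (Γ.ℓ k) hx hℓ.le (by linarith)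
    simp only [loopPt, this, le_refl, if_true]
    exact Γ.graph.edgePt_of_len_le _ le_rfl
  -- Position 0 is shared by the right vertex and the bridge, hence the assumption that the position
  -- is nonzero.
  · exact absurd (AddCircle.coe_zero _) hx0'
  · obtain rfl : k = i := hidx
    rename_i t
    have h1 : (t : ℝ) < Γ.ℓ k := t.2.2
    have := hmod t hx t.2.1.le (by linarith)
    simp only [loopPt, this, h1.le, if_true]
    exact Γ.graph.edgePt_of_mem _ t.2
  · obtain rfl : k = i := hidx
    rename_i t
    have h0 : 0 < (t : ℝ) := t.2.1
    have h1 : (t : ℝ) < Γ.m k := t.2.2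
    have := hmod (Γ.ℓ k + t) hx (by linarith) (by linarith)
    simp only [loopPt, this]
    rw [if_neg (by linarith), add_sub_cancel_left]
    exact Γ.graph.edgePt_of_mem _ t.2
  · exact absurd (AddCircle.coe_zero _) hx0'

theorem loopIndex_edgePt_top (i : Fin g) (t : ℝ) :
    Γ.loopIndex (Γ.graph.edgePt (.inl i) t) = i := by
  simp only [edgePt]
  split_ifs <;> rfl

theorem loopIndex_edgePt_bottom (i : Fin g) (t : ℝ) :
    Γ.loopIndex (Γ.graph.edgePt (.inr (.inl i)) t) = i := by
  simp only [edgePt]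
  split_ifs <;> rfl

theorem loopIndex_loopPt (i : Fin g) (x : ℝ) : Γ.loopIndex (Γ.loopPt i x) = i := by
  simp only [loopPt]
  split_ifs
  · exact loopIndex_edgePt_top i _
  · exact loopIndex_edgePt_bottom i _

theorem loopPos_loopPt (i : Fin g) (x : ℝ) :
    Γ.loopPos (Γ.loopPt i x) = toIcoMod (add_pos (Γ.ℓ_pos i) (Γ.m_pos i)) 0 x := by
  have hℓ := Γ.ℓ_pos i
  obtain ⟨h0, h1⟩ := toIcoMod_mem_Ico (add_pos (Γ.ℓ_pos i) (Γ.m_pos i)) 0 x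
  simp only [loopPt]
  generalize toIcoMod (add_pos (Γ.ℓ_pos i) (Γ.m_pos i)) 0 x = t at h0 h1
  split_ifs with h
  · rcases h0.eq_or_lt with rfl | h0
    · rw [edgePt_of_nonpos _ _ le_rfl]
      rfl
    rcases h.eq_or_lt with rfl | h
    · rw [edgePt_of_len_le _ _ (by exact le_rfl)]
      rfl
    · rw [edgePt_of_mem _ _ ⟨h0, h⟩]
      rfl
  · rw [edgePt_of_mem _ _ ⟨by linarith, show t - Γ.ℓ i < Γ.m i by linarith⟩]
    simp [loopPos]

theorem retract_loopPt_self (i : Fin g) (x : ℝ) :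
    (Γ.retract i (Γ.loopPt i x) : AddCircle (Γ.ℓ i + Γ.m i)) = x := by
  rw [retract, loopIndex_loopPt, if_neg (lt_irrefl i), if_pos rfl, loopPos_loopPt, ← sub_eq_zero,
    ← AddCircle.coe_sub, AddCircle.coe_eq_zero_iff]
  exact ⟨-toIcoDiv (add_pos (Γ.ℓ_pos i) (Γ.m_pos i)) 0 x, by
    rw [neg_smul, ← neg_sub, self_sub_toIcoMod]⟩

theorem retract_loopPt_of_lt {i k : Fin g} (h : k < i) (x : ℝ) :
    Γ.retract i (Γ.loopPt k x) = Γ.ℓ i := by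
  rw [retract, loopIndex_loopPt, if_pos h]

theorem retract_loopPt_of_gt {i k : Fin g} (h : i < k) (x : ℝ) :
    Γ.retract i (Γ.loopPt k x) = 0 := by
  rw [retract, loopIndex_loopPt, if_neg h.not_gt, if_neg h.ne']

theorem loopPt_mem (i : Fin g) (x : ℝ) : Γ.loopPt i x ∈
    range (Γ.graph.edgePt (Sum.inl i)) ∪ range (Γ.graph.edgePt (Sum.inr (Sum.inl i))) := by
  simp only [loopPt]
  split_ifs
  · exact Or.inl ⟨_, rfl⟩
  · exact Or.inr ⟨_, rfl⟩

theorem loopIndex_of_mem_cell {i : Fin g} {p : Γ.graph.Point} (hp : p ∈ Γ.cell i) :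
    Γ.loopIndex p = i := by
  rcases hp.1 with ⟨t, rfl⟩ | ⟨t, rfl⟩
  · exact loopIndex_edgePt_top i t
  · exact loopIndex_edgePt_bottom i t

/-- Translates the multiples of m in the definition of D_T into the multiples of ℓ that left degrees
produce. -/
theorem coe_mul_m (i : Fin g) (n : ℤ) : ((n * Γ.m i : ℝ) : AddCircle (Γ.ℓ i + Γ.m i)) =
    (-n) • (Γ.ℓ i : AddCircle (Γ.ℓ i + Γ.m i)) := by
  rw [← zsmul_eq_mul, AddCircle.coe_zsmul, eq_neg_of_add_eq_zero_right (coe_ℓ_add_coe_m i),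
    smul_neg, neg_smul]

end ChainOfLoops

/-! ### Divisors determined by a column function. -/

namespace ChainOfLoops

open MetricGraph

variable {g : ℕ} {Γ : ChainOfLoops g} {D : Γ.graph.Divisor} {r : ℕ}

/-- A column function for `D`: at the loop `i`, exactly the bound number `col i` lingers. -/
def IsColumn (Γ : ChainOfLoops g) (D : Γ.graph.Divisor) (col : Fin g → Fin (r + 1)) : Prop :=
  ∀ (i : Fin g) (k : Fin (r + 1)), lingerSeq (Γ.Lingers D) (i + 1) k =
    lingerSeq (Γ.Lingers D) i k + if col i = k then 0 else 1

namespace IsColumn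

variable {col : Fin g → Fin (r + 1)}

theorem succ_eq (hcol : Γ.IsColumn D col) (i : Fin g) : lingerSeq (Γ.Lingers D) (i + 1) (col i) =
    lingerSeq (Γ.Lingers D) i (col i) := by
  rw [hcol i (col i), if_pos rfl, add_zero]

theorem abelJacobi_eq (hcol : Γ.IsColumn D col) (i : Fin g) :
    Γ.abelJacobi i D =
      lingerSeq (Γ.Lingers D) i (col i) • (Γ.ℓ i : AddCircle (Γ.ℓ i + Γ.m i)) := by
  obtain ⟨_, h⟩ := (lingerSeq.linger_of_succ_eq _ (hcol.succ_eq i)).1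
  exact h.symm

/-- The path records the gaps below the top bound: a lingering of the bound k < r widens the gap k
by one, a lingering of the top bound narrows all gaps. -/
theorem path_eq (hcol : Γ.IsColumn D col) {s : ℕ} (T : RectTableau s (r + 1) g) {n : ℕ} (hn : n ≤ g)
    (hT : ∀ i : Fin g, (i : ℕ) < n → T.col i = col i) (k : Fin r) :
    T.path n k = lingerSeq (Γ.Lingers D) n r - lingerSeq (Γ.Lingers D) n k := by
  induction n with
  | zero => simp [RectTableau.path, lingerSeq]
  | succ n ih =>
    have hng : n < g := hn
    have h1 := hcol ⟨n, hng⟩ (Fin.last r)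
    have h2 := hcol ⟨n, hng⟩ k.castSucc
    simp only [Fin.val_last, Fin.val_castSucc, Fin.ext_iff] at h1 h2
    simp only [RectTableau.path]
    rw [ih hng.le fun i hi => hT i (by omega), dif_pos hng,
      hT ⟨n, hng⟩ (Nat.lt_succ_self n), h1, h2]
    have := k.2
    split_ifs <;> omega

theorem sum_eq (hcol : Γ.IsColumn D col) {n : ℕ} (hn : n ≤ g) :
    ∑ i : Fin g, (if (i : ℕ) < n ∧ (col i : ℕ) < r then (1 : ℤ) else 0) =
      lingerSeq (Γ.Lingers D) n r - r := by
  induction n with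
  | zero => simp [lingerSeq]
  | succ n ih =>
    have hng : n < g := hn
    have h1 := hcol ⟨n, hng⟩ (Fin.last r)
    simp only [Fin.val_last, Fin.ext_iff] at h1
    have hsplit : ∀ i : Fin g, (if (i : ℕ) < n + 1 ∧ (col i : ℕ) < r then (1 : ℤ) else 0) =
        (if (i : ℕ) < n ∧ (col i : ℕ) < r then 1 else 0) +
          if i = ⟨n, hng⟩ then (if (col i : ℕ) < r then 1 else 0) else 0 := by
      intro i
      simp only [Fin.ext_iff]
      split_ifs <;> omega
    rw [Finset.sum_congr rfl fun i _ => hsplit i, Finset.sum_add_distrib, ih hng.le, h1,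
      Finset.sum_ite_eq' Finset.univ, if_pos (Finset.mem_univ _)]
    have := (col ⟨n, hng⟩).2
    split_ifs <;> omega

/-- The points to the left number r plus the earlier loops outside the last column, which is the top
bound (`sum_eq`). The point on the loop i, if any, subtracts the gap from the top bound to the bound
`T.col i`. Only the columns before i must agree, which permits the induction in `col_unique`. -/
theorem abelJacobi_tableauDivisor (hcol : Γ.IsColumn D col) {s : ℕ}
    (T : RectTableau s (r + 1) g) {i : Fin g} (hT : ∀ k : Fin g, k < i → T.col k = col k) :
    Γ.abelJacobi i (Γ.tableauDivisor T) =
      lingerSeq (Γ.Lingers D) i (T.col i) • (Γ.ℓ i : AddCircle (Γ.ℓ i + Γ.m i)) := by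
  let Y : AddCircle (Γ.ℓ i + Γ.m i) := (lingerSeq (Γ.Lingers D) i (T.col i) -
    lingerSeq (Γ.Lingers D) i r) • (Γ.ℓ i : AddCircle (Γ.ℓ i + Γ.m i))
  have hterm : ∀ k : Fin g, Γ.abelJacobi i (if h : (T.col k : ℕ) < r then
      Finsupp.single (Γ.loopPt k (T.path k ⟨T.col k, h⟩ * Γ.m k)) 1 else 0) =
      (if (k : ℕ) < i ∧ (col k : ℕ) < r then (1 : ℤ) else 0) •
        (Γ.ℓ i : AddCircle (Γ.ℓ i + Γ.m i)) + if k = i then Y else 0 := by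
    intro k
    rcases lt_trichotomy k i with hk | rfl | hk
    · rw [if_neg hk.ne, add_zero, ← hT k hk]
      split_ifs with h1 h2 h2
      · rw [abelJacobi_single, retract_loopPt_of_lt hk]
      · exact absurd ⟨hk, h1⟩ h2
      · exact absurd h2.2 h1
      · simp
    · rw [if_neg (by simp), zero_smul, zero_add, if_pos rfl]
      split_ifs with h
      · rw [abelJacobi_single, retract_loopPt_self, one_smul, coe_mul_m,
          hcol.path_eq T k.2.le (fun k' hk' => hT k' hk'), neg_sub]
      · have : (T.col k : ℕ) = r := by omega
        simp [Y, this]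
    · rw [if_neg hk.ne', add_zero, if_neg (by rw [Fin.lt_def] at hk; omega), zero_smul]
      split_ifs
      · rw [abelJacobi_single, retract_loopPt_of_gt hk, AddCircle.coe_zero, smul_zero]
      · exact map_zero _
  rw [tableauDivisor, map_add, map_sum, Finset.sum_congr rfl fun k _ => hterm k,
    Finset.sum_add_distrib, ← Finset.sum_smul, hcol.sum_eq i.2.le, abelJacobi_single,
    retract_vFirst, Finset.sum_ite_eq' Finset.univ, if_pos (Finset.mem_univ _), ← add_smul,
    ← add_smul]
  congr 1
  ring

variable {N : ℤ}

theorem _root_.ChainOfLoops.lingerSeq_le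
    (hB : ∀ k : Fin (r + 1), lingerSeq (Γ.Lingers D) g k ≤ N) (i : Fin g) (k : Fin (r + 1)) :
    lingerSeq (Γ.Lingers D) i k ≤ N :=
  (lingerSeq.monotone_left _ k i.2.le).trans (hB k)

theorem eq_of_lingers (hcol : Γ.IsColumn D col) (hΓ : Γ.IsGeneric) (hN : N + 2 ≤ 2 * g)
    (hB : ∀ k : Fin (r + 1), lingerSeq (Γ.Lingers D) g k ≤ N)
    {i : Fin g} {a : ℤ} (ha : 0 ≤ a) (haN : a ≤ N) (h : Γ.Lingers D i a) :
    a = lingerSeq (Γ.Lingers D) i (col i) := by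
  obtain ⟨_, h⟩ := h
  exact hΓ.zsmul_inj i ha haN (lingerSeq.nonneg _ _ _) (lingerSeq_le hB i (col i)) hN
    (h.trans (hcol.abelJacobi_eq i))

theorem col_eq_of_lingers (hcol : Γ.IsColumn D col) (hΓ : Γ.IsGeneric) (hN : N + 2 ≤ 2 * g)
    (hB : ∀ k : Fin (r + 1), lingerSeq (Γ.Lingers D) g k ≤ N)
    {i : Fin g} {k : Fin (r + 1)}
    (h : Γ.Lingers D i (lingerSeq (Γ.Lingers D) i k)) : col i = k :=
  Fin.ext ((lingerSeq.strictMono (Γ.Lingers D) i).injective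
    (hcol.eq_of_lingers hΓ hN hB (lingerSeq.nonneg _ _ _) (lingerSeq_le hB i k) h)).symm

theorem col_unique (hcol : Γ.IsColumn D col) (hΓ : Γ.IsGeneric) (hN : N + 2 ≤ 2 * g)
    (hB : ∀ k : Fin (r + 1), lingerSeq (Γ.Lingers D) g k ≤ N)
    {s : ℕ} (T : RectTableau s (r + 1) g) (hT : Γ.tableauDivisor T = D)
    (i : Fin g) : T.col i = col i := by
  induction i using WellFoundedLT.induction with
  | ind i ih =>
    refine (hcol.col_eq_of_lingers hΓ hN hB ⟨i.2, ?_⟩).symm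
    rw [← hcol.abelJacobi_tableauDivisor T ih, hT]

section Structure

variable {j : Fin (r + 1)} {F : Γ.graph.Divisor}

/-- Coefficient j at v_1 suffices, without a forcing divisor: a bound at the lingering value is the
one that lingers, so a divisor meeting any other bound exactly must gain a point. -/
theorem lingerSeq_le_leftDeg (hcol : Γ.IsColumn D col) (hΓ : Γ.IsGeneric) (hN : N + 2 ≤ 2 * g)
    (hB : ∀ k : Fin (r + 1), lingerSeq (Γ.Lingers D) g k ≤ N)
    (hF : 0 ≤ F) (hv : (j : ℤ) ≤ F Γ.vFirst) (hAJ : ∀ i, Γ.abelJacobi i F = Γ.abelJacobi i D)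
    {n : ℕ} (hn : n ≤ g) :
    lingerSeq (Γ.Lingers D) n j ≤ Γ.leftDeg n F := by
  induction n with
  | zero => simpa [lingerSeq, leftDeg_zero] using hv
  | succ n ih =>
    have hng : n < g := hn
    have h1 := ih hng.le
    have h2 := leftDeg_le_succ hF n
    have h3 := hcol ⟨n, hng⟩ j
    simp only at h3
    split_ifs at h3 with hc
    · omega
    · by_contra! hlt
      refine hc (hcol.col_eq_of_lingers hΓ hN hB ?_)
      change Γ.Lingers D n (lingerSeq (Γ.Lingers D) n j)
      rw [show lingerSeq (Γ.Lingers D) n j = Γ.leftDeg n F by omega]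
      exact lingers_of_leftDeg_eq hF (i := ⟨n, hng⟩) (hAJ _)
        (show Γ.leftDeg (n + 1) F = Γ.leftDeg n F by omega)

/-- Equality holds at the right end by degree and propagates leftwards. An excess before a loop but
not after it puts F at the lingering value, held by a bound of index above j. That bound stays while
the bound j catches up with it, against strict monotonicity. -/
theorem leftDeg_eq (hcol : Γ.IsColumn D col) (hΓ : Γ.IsGeneric) (hN : N + 2 ≤ 2 * g)
    (hB : ∀ k : Fin (r + 1), lingerSeq (Γ.Lingers D) g k ≤ N)
    (hF : 0 ≤ F) (hv : (j : ℤ) ≤ F Γ.vFirst) (hAJ : ∀ i, Γ.abelJacobi i F = Γ.abelJacobi i D)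
    (hdeg : Γ.graph.degree F = lingerSeq (Γ.Lingers D) g j)
    {n : ℕ} (hn : n ≤ g) : Γ.leftDeg n F = lingerSeq (Γ.Lingers D) n j := by
  induction hn using Nat.decreasingInduction with
  | self => rw [leftDeg_last, hdeg]
  | of_succ n hng ih =>
    have h1 := hcol.lingerSeq_le_leftDeg hΓ hN hB hF hv hAJ hng.le
    refine le_antisymm ?_ h1
    by_contra! hlt
    have h2 := leftDeg_le_succ hF n
    have h3 := lingerSeq.succ_eq_or (Γ.Lingers D) n j
    have h4 : Γ.leftDeg (n + 1) F = Γ.leftDeg n F := by omega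
    have h5 : Γ.leftDeg n F ≤ N := by
      have : lingerSeq (Γ.Lingers D) (n + 1) j ≤ lingerSeq (Γ.Lingers D) g j :=
        lingerSeq.monotone_left (Γ.Lingers D) j hng
      have := hB j
      omega
    have h6 := hcol.eq_of_lingers hΓ hN hB (i := ⟨n, hng⟩)
      ((lingerSeq.nonneg _ n j).trans h1) h5 (lingers_of_leftDeg_eq hF (hAJ _) h4)
    have h7 := hcol.succ_eq ⟨n, hng⟩
    simp only at h6 h7
    have h8 : (j : ℕ) < col ⟨n, hng⟩ :=
      (lingerSeq.strictMono (Γ.Lingers D) n).lt_iff_lt.1 (by omega)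
    have h9 := lingerSeq.strictMono (Γ.Lingers D) (n + 1) h8
    omega

theorem coeff_eq_zero (hcol : Γ.IsColumn D col) (hΓ : Γ.IsGeneric) (hN : N + 2 ≤ 2 * g)
    (hB : ∀ k : Fin (r + 1), lingerSeq (Γ.Lingers D) g k ≤ N)
    (hF : 0 ≤ F) (hv : (j : ℤ) ≤ F Γ.vFirst) (hAJ : ∀ i, Γ.abelJacobi i F = Γ.abelJacobi i D)
    (hdeg : Γ.graph.degree F = lingerSeq (Γ.Lingers D) g j)
    {i : Fin g} (hi : col i = j) {p : Γ.graph.Point}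
    (hp : Γ.zone p = i + 1) : F p = 0 := by
  refine coeff_eq_zero_of_leftDeg_eq hF ?_ hp
  have h1 := hcol i j
  rw [if_pos hi, add_zero] at h1
  rw [hcol.leftDeg_eq hΓ hN hB hF hv hAJ hdeg i.2, h1,
    hcol.leftDeg_eq hΓ hN hB hF hv hAJ hdeg i.2.le]

/-- The left degree grows by one, so the zone holds a single point, placed by the Abel–Jacobi
component. Its position is nonzero because the bound j is not at the lingering value, so it lies
neither at w_i nor on the bridge. -/
theorem coeff_eq_single (hcol : Γ.IsColumn D col) (hΓ : Γ.IsGeneric) (hN : N + 2 ≤ 2 * g)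
    (hB : ∀ k : Fin (r + 1), lingerSeq (Γ.Lingers D) g k ≤ N)
    (hF : 0 ≤ F) (hv : (j : ℤ) ≤ F Γ.vFirst) (hAJ : ∀ i, Γ.abelJacobi i F = Γ.abelJacobi i D)
    (hdeg : Γ.graph.degree F = lingerSeq (Γ.Lingers D) g j)
    {i : Fin g} (hi : col i ≠ j) {x : ℝ}
    (hx : x = ((lingerSeq (Γ.Lingers D) i j - lingerSeq (Γ.Lingers D) i (col i) : ℤ) : ℝ) *
      Γ.m i) :
    Γ.zone (Γ.loopPt i x) = i + 1 ∧ Γ.loopPt i x ≠ Γ.w i ∧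
      ∀ p, Γ.zone p = i + 1 → F p = Finsupp.single (Γ.loopPt i x) (1 : ℤ) p := by
  have h1 := hcol i j
  rw [if_neg hi] at h1
  have h2 := hcol.leftDeg_eq hΓ hN hB hF hv hAJ hdeg i.2.le
  have h3 : Γ.leftDeg (i + 1) F = Γ.leftDeg i F + 1 := by
    rw [hcol.leftDeg_eq hΓ hN hB hF hv hAJ hdeg i.2, h1, h2]
  obtain ⟨p, hp, hp0⟩ := exists_zone_eq_of_leftDeg_ne (i := i) (F := F) (by omega)
  have hp1 : 1 ≤ F p := by
    have : 0 ≤ F p := hF p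
    omega
  have hF' := sub_single_nonneg hF hp1
  have h4 : Γ.leftDeg (i + 1) (F - Finsupp.single p 1) =
      Γ.leftDeg i (F - Finsupp.single p 1) := by
    rw [map_sub, map_sub, leftDeg_single, leftDeg_single, hp, if_pos le_rfl, if_neg (by omega)]
    omega
  have h5 := abelJacobi_of_leftDeg_eq hF' h4
  rw [map_sub, map_sub, leftDeg_single, hp, if_neg (by omega), abelJacobi_single, one_smul, hAJ,
    hcol.abelJacobi_eq, sub_zero, h2, sub_eq_iff_eq_add] at h5
  have hxp : (x : AddCircle (Γ.ℓ i + Γ.m i)) = Γ.retract i p := by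
    rw [hx, coe_mul_m, neg_sub, sub_smul, h5, add_sub_cancel_left]
  have hx0 : (x : AddCircle (Γ.ℓ i + Γ.m i)) ≠ 0 := by
    rw [hx, coe_mul_m, neg_sub, sub_smul, Ne, sub_eq_zero]
    intro h
    exact hi (hcol.col_eq_of_lingers hΓ hN hB
      ⟨i.2, by rw [hcol.abelJacobi_eq i, h]⟩)
  have hpt := loopPt_eq_of_retract hp hxp hx0
  refine ⟨by rw [hpt, hp], fun hw => hx0 ?_, fun q hq => ?_⟩
  · rw [← retract_loopPt_self, hw, retract_w, AddCircle.coe_zero]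
  · have := coeff_eq_zero_of_leftDeg_eq hF' h4 hq
    rw [Finsupp.sub_apply, sub_eq_zero] at this
    rw [hpt, this]

theorem eq_formula (hcol : Γ.IsColumn D col) (hΓ : Γ.IsGeneric) (hN : N + 2 ≤ 2 * g)
    (hB : ∀ k : Fin (r + 1), lingerSeq (Γ.Lingers D) g k ≤ N)
    (hF : 0 ≤ F) (hv : (j : ℤ) ≤ F Γ.vFirst) (hAJ : ∀ i, Γ.abelJacobi i F = Γ.abelJacobi i D)
    (hdeg : Γ.graph.degree F = lingerSeq (Γ.Lingers D) g j) :
    F = Finsupp.single Γ.vFirst (j : ℤ) +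
    ∑ i : Fin g, if col i = j then 0 else Finsupp.single (Γ.loopPt i
      (((lingerSeq (Γ.Lingers D) i j - lingerSeq (Γ.Lingers D) i (col i) : ℤ) : ℝ) * Γ.m i))
      (1 : ℤ) := by
  classical
  have hsing : ∀ {p q : Γ.graph.Point}, Γ.zone p ≠ Γ.zone q → ∀ n : ℤ,
      Finsupp.single p n q = 0 := fun h n =>
    Finsupp.single_eq_of_ne fun h' => h (congrArg Γ.zone h'.symm)
  have hzone : ∀ i, col i ≠ j → Γ.zone (Γ.loopPt i
      (((lingerSeq (Γ.Lingers D) i j - lingerSeq (Γ.Lingers D) i (col i) : ℤ) : ℝ) * Γ.m i)) =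
      i + 1 := fun i hi => (hcol.coeff_eq_single hΓ hN hB hF hv hAJ hdeg hi rfl).1
  ext q
  rw [Finsupp.add_apply, Finsupp.finsetSum_apply]
  by_cases hq : q = Γ.vFirst
  · subst hq
    rw [Finset.sum_eq_zero, Finsupp.single_eq_same, add_zero, ← leftDeg_zero,
      hcol.leftDeg_eq hΓ hN hB hF hv hAJ hdeg (Nat.zero_le g), lingerSeq]
    intro i _
    split_ifs with hi
    · rfl
    · exact hsing (by rw [hzone i hi, zone_vFirst]; omega) 1
  · have hz := Γ.zone_of_ne hq
    rw [hsing (by rw [zone_vFirst, hz]; omega), zero_add,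
      Finset.sum_eq_single (Γ.loopIndex q)]
    · split_ifs with hi
      · exact hcol.coeff_eq_zero hΓ hN hB hF hv hAJ hdeg hi hz
      · exact (hcol.coeff_eq_single hΓ hN hB hF hv hAJ hdeg hi rfl).2.2 q hz
    · intro i _ hne
      split_ifs with hi
      · rfl
      · refine hsing ?_ 1
        rw [hzone i hi, hz]
        intro h
        exact hne (Fin.ext (by omega))
    · simp

end Structure

end IsColumn

end ChainOfLoops

/-! ### From Brill–Noether number zero to the tableau and the main theorem. -/

namespace ChainOfLoops

open MetricGraph

variable {g : ℕ} {Γ : ChainOfLoops g} {D : Γ.graph.Divisor} {r d : ℕ}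

/-- As g > 0, the factor g - d + r is positive, so the natural subtraction is not truncated. Also r
+ 1 ≤ g, whence d ≤ g + r - 1 ≤ 2g - 2: left degrees up to d are in the range of genericity. -/
theorem mul_eq_of_brillNoether_eq_zero (hg : 0 < g) (hρ : brillNoether g r d = 0) :
    (r + 1) * (g + r - d) = g ∧ d + (g + r - d) = g + r ∧ d + 2 ≤ 2 * g := by
  rw [brillNoether, sub_eq_zero] at hρ
  have hpos : 0 < (g : ℤ) - d + r := by
    by_contra! h
    have : ((r : ℤ) + 1) * (g - d + r) ≤ 0 := mul_nonpos_of_nonneg_of_nonpos (by omega) h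
    omega
  have hle : d ≤ g + r := by omega
  have hmul : (r + 1) * (g + r - d) = g := by
    zify [hle]
    rw [show (g : ℤ) + r - d = g - d + r by ring]
    exact hρ.symm
  refine ⟨hmul, by omega, ?_⟩
  have : r + 1 ≤ g := hmul ▸ Nat.le_mul_of_pos_right _ (by omega)
  omega

theorem exists_isColumn (hΓ : Γ.IsGeneric) (hρ : brillNoether g r d = 0)
    (hdeg : Γ.graph.degree D = d) (hrank : Γ.graph.RankAtLeast D r) :
    ∃ col : Fin g → Fin (r + 1), Γ.IsColumn D col ∧
      ∀ b, (Finset.univ.filter fun i => col i = b).card = g + r - d := by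
  obtain ⟨h1, h2, h3⟩ := mul_eq_of_brillNoether_eq_zero Γ.g_pos hρ
  have hlast := fun {k : ℕ} (hk : k ≤ r) => lingerSeq_last_le hrank hk
  rw [hdeg] at hlast
  refine lingerSeq.exists_col _ h1 (fun k hk => ?_) ?_
  · have := hlast hk
    omega
  · rintro i hi k hk k' hk' ⟨_, h⟩ ⟨_, h'⟩
    have hle : ∀ {k : ℕ}, k ≤ r → lingerSeq (Γ.Lingers D) i k ≤ d := fun {k} hk => by
      have h4 : lingerSeq (Γ.Lingers D) i k ≤ lingerSeq (Γ.Lingers D) g k :=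
        lingerSeq.monotone_left _ k hi.le
      have := hlast hk
      omega
    exact (lingerSeq.strictMono (Γ.Lingers D) i).injective
      (hΓ.zsmul_inj ⟨i, hi⟩ (lingerSeq.nonneg _ _ _) (hle hk) (lingerSeq.nonneg _ _ _) (hle hk')
        (by omega) (h.trans h'.symm))

/-- Column k has k + n - b_n(k) entries among the first n, so strict monotonicity of the bounds
makes these counts weakly decreasing in k. -/
theorem IsColumn.exists_tableau {s : ℕ} {col : Fin g → Fin (r + 1)} (hcol : Γ.IsColumn D col)
    (hcard : ∀ b, (Finset.univ.filter fun i => col i = b).card = s) :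
    ∃ T : RectTableau s (r + 1) g, ∀ i, T.col i = col i := by
  have hdom : ∀ n ≤ g, ∀ b b' : Fin (r + 1), b < b' →
      (Finset.univ.filter fun i : Fin g => (i : ℕ) < n ∧ col i = b').card ≤
        (Finset.univ.filter fun i : Fin g => (i : ℕ) < n ∧ col i = b).card := by
    intro n hn b b' hb
    suffices h : ∀ k (hk : k + 1 < r + 1),
        (Finset.univ.filter fun i : Fin g => (i : ℕ) < n ∧ col i = ⟨k + 1, hk⟩).card ≤
        (Finset.univ.filter fun i : Fin g => (i : ℕ) < n ∧ col i = ⟨k, by omega⟩).card by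
      have hanti : Antitone fun b : Fin (r + 1) =>
          (Finset.univ.filter fun i : Fin g => (i : ℕ) < n ∧ col i = b).card :=
        Fin.antitone_iff_succ_le.2 fun k => h k (by omega)
      exact hanti hb.le
    intro k hk
    have h1 := lingerSeq.eq_add_sub_card_col _ hcol hn ⟨k + 1, hk⟩
    have h2 := lingerSeq.eq_add_sub_card_col _ hcol hn ⟨k, by omega⟩
    have h3 := lingerSeq.strictMono (Γ.Lingers D) n (Nat.lt_add_one k)
    simp only at h1 h2
    omega
  refine RectTableau.exists_of_col col hcard fun n b b' hb => ?_
  rcases le_total n g with hn | hn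
  · exact hdom n hn b b' hb
  · have := hdom g le_rfl b b' hb
    have hiff : ∀ i : Fin g, ((i : ℕ) < n) ↔ ((i : ℕ) < g) := fun i => by omega
    simpa only [hiff] using this

theorem IsColumn.tableauDivisor_eq {s : ℕ} {col : Fin g → Fin (r + 1)}
    (hcol : Γ.IsColumn D col) (T : RectTableau s (r + 1) g) (hT : ∀ i, T.col i = col i) :
    Γ.tableauDivisor T = Finsupp.single Γ.vFirst (r : ℤ) +
      ∑ i : Fin g, if col i = Fin.last r then 0 else Finsupp.single (Γ.loopPt i
        (((lingerSeq (Γ.Lingers D) i r - lingerSeq (Γ.Lingers D) i (col i) : ℤ) : ℝ) * Γ.m i))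
        (1 : ℤ) := by
  rw [tableauDivisor]
  congr 1
  refine Finset.sum_congr rfl fun i _ => ?_
  have hi := (T.col i).2
  by_cases h : (T.col i : ℕ) < r
  · rw [dif_pos h, if_neg (by rw [← hT i, Fin.ext_iff, Fin.val_last]; omega),
      hcol.path_eq T i.2.le fun k _ => hT k, ← hT i]
  · rw [dif_neg h, if_pos (by rw [← hT i, Fin.ext_iff, Fin.val_last]; omega)]

/-- The bounds start as consecutive integers, so only the lowest has room to linger at the first
loop. -/
theorem IsColumn.eq_zero_of_col_first {col : Fin g → Fin (r + 1)} (hcol : Γ.IsColumn D col) :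
    (col ⟨0, Γ.g_pos⟩ : ℕ) = 0 := by
  rcases (lingerSeq.linger_of_succ_eq _ (hcol.succ_eq ⟨0, Γ.g_pos⟩)).2 with h | h
  · exact h
  · by_contra h0
    simp only [lingerSeq] at h
    omega

theorem sub_single_wLast_nonneg {D' : Γ.graph.Divisor} {j : Fin (r + 1)}
    (h : 0 ≤ D' - Finsupp.single Γ.vFirst (j : ℤ) - Finsupp.single Γ.wLast ((r : ℤ) - j)) :
    0 ≤ D' - Finsupp.single Γ.wLast ((r : ℤ) - j) ∧
      (j : ℤ) ≤ (D' - Finsupp.single Γ.wLast ((r : ℤ) - j)) Γ.vFirst := by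
  rw [sub_right_comm, sub_nonneg] at h
  refine ⟨le_trans (Finsupp.single_nonneg.2 (by omega)) h, ?_⟩
  simpa using h Γ.vFirst

end ChainOfLoops

end

open MetricGraph ChainOfLoops in
theorem mainTheorem9 {g : ℕ} (Γ : ChainOfLoops g) (hΓ : Γ.IsGeneric) (r d : ℕ)
    (hρ : brillNoether g r d = 0)
    (D : Γ.graph.Divisor) (hred : Γ.graph.IsReduced Γ.vFirst D)
    (hdeg : Γ.graph.degree D = d) (hrank : Γ.graph.RankAtLeast D r) :
    (∃! T : RectTableau (g + r - d) (r + 1) g, Γ.tableauDivisor T = D) ∧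
    ∀ j : Fin (r + 1),
      (∃! D' : Γ.graph.Divisor, Γ.graph.LinEquiv D' D ∧
        0 ≤ D' - Finsupp.single Γ.vFirst (j : ℤ) - Finsupp.single Γ.wLast ((r : ℤ) - j)) ∧
      ∀ D' : Γ.graph.Divisor, Γ.graph.LinEquiv D' D →
        0 ≤ D' - Finsupp.single Γ.vFirst (j : ℤ) - Finsupp.single Γ.wLast ((r : ℤ) - j) →
        ∀ T : RectTableau (g + r - d) (r + 1) g, Γ.tableauDivisor T = D →
          ∀ i : Fin g, (∀ p ∈ Γ.cell i, ¬ 0 < D' p) ↔ T.col i = j := by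
  obtain ⟨-, hs, hdg⟩ := mul_eq_of_brillNoether_eq_zero Γ.g_pos hρ
  obtain ⟨col, hcol, hcard⟩ := exists_isColumn hΓ hρ hdeg hrank
  have hN : (d : ℤ) + 2 ≤ 2 * g := by omega
  have hlast : ∀ k : Fin (r + 1), lingerSeq (Γ.Lingers D) g k = d - r + k := by
    intro k
    have h1 := lingerSeq.eq_add_sub_card_col _ hcol le_rfl k
    have h2 : (Finset.univ.filter fun i : Fin g => (i : ℕ) < g ∧ col i = k).card = g + r - d := by
      rw [← hcard k]
      exact congrArg _ (Finset.filter_congr fun i _ => by simp)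
    omega
  have hB : ∀ k : Fin (r + 1), lingerSeq (Γ.Lingers D) g k ≤ d := fun k => by
    have := hlast k
    omega
  -- By the rank, the class contains an effective divisor with coefficient at least r at v_1; the
  -- reduced divisor has there at least as much.
  have hvr : (r : ℤ) ≤ D Γ.vFirst := by
    obtain ⟨F, hF, hDF⟩ := hrank (Finsupp.single Γ.vFirst (r : ℤ))
      (Finsupp.single_nonneg.2 (Int.natCast_nonneg r)) (degree_single _ _)
    have hDF' : Γ.graph.LinEquiv D (F + Finsupp.single Γ.vFirst (r : ℤ)) :=
      hDF.of_sub_eq_sub (by abel)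
    have h1 := hred.coeff_le
      (add_nonneg hF (Finsupp.single_nonneg.2 (Int.natCast_nonneg r))) hDF'
    rw [Finsupp.add_apply, Finsupp.single_eq_same] at h1
    have h2 : 0 ≤ F Γ.vFirst := hF Γ.vFirst
    omega
  have hD0 : 0 ≤ D := fun p => by
    by_cases hp : p = Γ.vFirst
    · subst hp
      exact (Int.natCast_nonneg r).trans hvr
    · exact hred.1 p hp
  have hDform := hcol.eq_formula hΓ hN hB (j := Fin.last r) hD0 (by simpa using hvr)
    (fun _ => rfl) (by rw [hdeg, hlast, Fin.val_last]; ring)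
  have hunique : ∀ T : RectTableau (g + r - d) (r + 1) g, Γ.tableauDivisor T = D →
      ∀ i, T.col i = col i := fun T hT => hcol.col_unique hΓ hN hB T hT
  obtain ⟨T, hT⟩ := hcol.exists_tableau hcard
  refine ⟨⟨T, ?_, fun T' hT' => ?_⟩, fun j => ?_⟩
  · exact (hcol.tableauDivisor_eq T hT).trans hDform.symm
  · exact RectTableau.eq_of_col_eq fun i => (hunique T' hT' i).trans (hT i).symm
  have hAJ : ∀ D' : Γ.graph.Divisor, Γ.graph.LinEquiv D' D → ∀ i, Γ.abelJacobi i
      (D' - Finsupp.single Γ.wLast ((r : ℤ) - j)) = Γ.abelJacobi i D := fun D' h i => by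
    rw [map_sub, abelJacobi_single, retract_wLast, AddCircle.coe_zero, smul_zero, sub_zero,
      Γ.abelJacobi_eq_of_linEquiv h]
  have hdeg' : ∀ D' : Γ.graph.Divisor, Γ.graph.LinEquiv D' D → Γ.graph.degree
      (D' - Finsupp.single Γ.wLast ((r : ℤ) - j)) = lingerSeq (Γ.Lingers D) g j := fun D' h => by
    rw [degree_sub, degree_single, h.degree_eq, hdeg, hlast]
    ring
  refine ⟨?_, fun D' hD' heff T' hT' i => ?_⟩
  · obtain ⟨F, hF, hDF⟩ := hrank
      (Finsupp.single Γ.vFirst (j : ℤ) + Finsupp.single Γ.wLast ((r : ℤ) - j))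
      (add_nonneg (Finsupp.single_nonneg.2 (by omega)) (Finsupp.single_nonneg.2 (by omega)))
      (by rw [degree_add, degree_single, degree_single]; ring)
    refine existsUnique_of_exists_of_unique
      ⟨F + (Finsupp.single Γ.vFirst (j : ℤ) + Finsupp.single Γ.wLast ((r : ℤ) - j)),
        hDF.symm.of_sub_eq_sub (by abel), ?_⟩ ?_
    · rwa [sub_sub, add_sub_cancel_right]
    · rintro D₁ D₂ ⟨h₁, e₁⟩ ⟨h₂, e₂⟩
      obtain ⟨p₁, v₁⟩ := sub_single_wLast_nonneg e₁
      obtain ⟨p₂, v₂⟩ := sub_single_wLast_nonneg e₂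
      exact sub_left_injective
        ((hcol.eq_formula hΓ hN hB p₁ v₁ (hAJ D₁ h₁) (hdeg' D₁ h₁)).trans
          (hcol.eq_formula hΓ hN hB p₂ v₂ (hAJ D₂ h₂) (hdeg' D₂ h₂)).symm)
  · obtain ⟨hF, hv⟩ := sub_single_wLast_nonneg heff
    rw [hunique T' hT' i]
    constructor
    · intro hcell
      by_contra hi
      obtain ⟨hz, hw, hp⟩ :=
        hcol.coeff_eq_single hΓ hN hB hF hv (hAJ D' hD') (hdeg' D' hD') hi rfl
      refine hcell _ ⟨loopPt_mem i _, hw⟩ ?_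
      have h1 := hp _ hz
      rw [Finsupp.single_eq_same, Finsupp.sub_apply] at h1
      have h2 : ∀ q, 0 ≤ Finsupp.single Γ.wLast ((r : ℤ) - j) q := fun q =>
        (Finsupp.single_nonneg.2 (by omega : (0 : ℤ) ≤ (r : ℤ) - j)) q
      have h3 := h2 (Γ.loopPt i (((lingerSeq (Γ.Lingers D) i j -
        lingerSeq (Γ.Lingers D) i (col i) : ℤ) : ℝ) * Γ.m i))
      omega
    · intro hi p hp
      have hidx := loopIndex_of_mem_cell hp
      have hpw : p ≠ Γ.wLast := by
        rintro rfl
        refine hp.2 ?_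
        rw [← hidx]
        rfl
      have hDp : D' p = (D' - Finsupp.single Γ.wLast ((r : ℤ) - j)) p := by
        rw [Finsupp.sub_apply, Finsupp.single_eq_of_ne hpw, sub_zero]
      rw [hDp, not_lt]
      -- The vertex v_1 lies in the first cell but has zone 0, so it needs its own argument: the
      -- first loop has column 0, hence j = 0 and the coefficient at v_1 is b_0(0) = 0.
      by_cases hpv : p = Γ.vFirst
      · subst hpv
        have hi0 : i = ⟨0, Γ.g_pos⟩ := hidx.symm
        have hj : (j : ℕ) = 0 := by
          rw [← hi, hi0]
          exact hcol.eq_zero_of_col_first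
        rw [← leftDeg_zero,
          hcol.leftDeg_eq hΓ hN hB hF hv (hAJ D' hD') (hdeg' D' hD') (Nat.zero_le g), lingerSeq,
          hj]
        simp
      · exact (hcol.coeff_eq_zero hΓ hN hB hF hv (hAJ D' hD') (hdeg' D' hD') hi
          (by rw [Γ.zone_of_ne hpv, hidx])).le
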